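/- A state of three qubits is a positive semidefinite operator $\rho$ of trace one on $\mathbb C^2\otimes\mathbb C^2\otimes\mathbb C^2$. It is called PPT if its partial transposes $\rho^{t_A},\rho^{t_B},\rho^{t_C}$ with respect to each of the three tensor factors are positive semidefinite. It is called fully separable if it is a finite convex combination of projectors $|e\otimes f\otimes g\rangle\langle e\otimes f\otimes g|$ onto product unit vectors, with $e,f,g\in\mathbb C^2$. Then every PPT state $\rho$ of three qubits of rank $3$ is fully separable. Moreover, there is no PPT entangled state of three qubits of rank smaller than $4$: no PPT state of three qubits with rank at most $3$ fails to be fully separable. -/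

import Mathlib

open scoped Kronecker Matrix ComplexOrder

namespace ThreeParty

variable {a b c : Type*}

/-- Partial transpose of an operator on `ℂ^a ⊗ ℂ^b ⊗ ℂ^c` with respect to the first party. -/
def ptA (ρ : Matrix (a × b × c) (a × b × c) ℂ) : Matrix (a × b × c) (a × b × c) ℂ :=
  Matrix.of fun x y => ρ (y.1, x.2.1, x.2.2) (x.1, y.2.1, y.2.2)

/-- Partial transpose with respect to the second party. -/
def ptB (ρ : Matrix (a × b × c) (a × b × c) ℂ) : Matrix (a × b × c) (a × b × c) ℂ :=
  Matrix.of fun x y => ρ (x.1, y.2.1, x.2.2) (y.1, x.2.1, y.2.2)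

/-- Partial transpose with respect to the third party. -/
def ptC (ρ : Matrix (a × b × c) (a × b × c) ℂ) : Matrix (a × b × c) (a × b × c) ℂ :=
  Matrix.of fun x y => ρ (x.1, x.2.1, y.2.2) (y.1, y.2.1, x.2.2)

/-- A (mixed) state: a positive semidefinite matrix of trace one. -/
structure IsState {n : Type*} [Fintype n] (ρ : Matrix n n ℂ) : Prop where
  posSemidef : ρ.PosSemidef
  trace_eq_one : ρ.trace = 1

/-- A PPT state of three parties: a state whose partial transpose is positive semidefinite for
each of the three bipartitions A|BC, B|AC, C|AB. (The partial transpose with respect to two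
parties is the full transpose of the partial transpose with respect to the remaining one, hence
is positive semidefinite exactly when the latter is.) -/
structure IsPPTState [Fintype a] [Fintype b] [Fintype c]
    (ρ : Matrix (a × b × c) (a × b × c) ℂ) : Prop extends IsState ρ where
  ptA_posSemidef : (ptA ρ).PosSemidef
  ptB_posSemidef : (ptB ρ).PosSemidef
  ptC_posSemidef : (ptC ρ).PosSemidef

/-- The matrix `|v⟩⟨v|`: the orthogonal projector onto the line of `v` when `v` is a unit
vector. -/
def proj {n : Type*} (v : n → ℂ) : Matrix n n ℂ :=
  Matrix.vecMulVec v (star v)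

/-- Full separability: `ρ` is a finite convex combination of projectors onto product unit
vectors `e ⊗ f ⊗ g`. -/
def IsFullySeparable [Fintype a] [Fintype b] [Fintype c]
    (ρ : Matrix (a × b × c) (a × b × c) ℂ) : Prop :=
  ∃ (m : ℕ) (p : Fin m → ℝ) (e : Fin m → a → ℂ) (f : Fin m → b → ℂ) (g : Fin m → c → ℂ),
    (∀ i, 0 ≤ p i) ∧ ∑ i, p i = 1 ∧
    (∀ i, star (e i) ⬝ᵥ e i = 1 ∧ star (f i) ⬝ᵥ f i = 1 ∧ star (g i) ⬝ᵥ g i = 1) ∧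
    ρ = ∑ i, p i • (proj (e i) ⊗ₖ (proj (f i) ⊗ₖ proj (g i)))

end ThreeParty

namespace ThreeParty

/-! Write ρ = T*T with T having rank-many independent rows, and split off one qubit. A vector x of
that qubit gives a slice T_x, sending h to T(x ⊗ h). The partial transpose ρ^Γ pairs x̄ ⊗ h with ȳ ⊗
h' as T_y h with T_x h', so its positivity constrains the slices (`slice_orthogonal`,
`slice_normal`).

There are two cases. If some T_x has a right inverse W, every T_y W is normal; diagonalising one of
them writes ρ as a sum of at most rank ρ projectors onto e_i ⊗ φ_i (`exists_product_decomposition`).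
If no slice has full rank, all slices factor through a common smaller space (`slice_factorization`).

Two qubits come first. Rank at most 2 is covered by this dichotomy. If both σ and σ^Γ have larger
rank, a dimension count gives a traceless Hermitian direction that fixes both kernels; moving along
it both ways lowers the rank of σ ⊕ σ^Γ, and σ lies between the two endpoints
(`mem_sepCone_of_ppt`).

For three qubits of rank at most 3, split off A. In the first case ρ has at most three terms e_i ⊗
φ_i. If two of the e_i are parallel, contracting A reduces to two-qubit operators; if they are
pairwise independent, the B-transpose forces each φ_i to be a product
(`det_eq_zero_of_pairwise_independent`). In the second case BC is compressed by Q to two dimensions,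
and the slices of Q along B form a pencil of 2 × 2 matrices. A nonsingular member gives a B-slice of
full rank, so the first case applies with A and B exchanged. A singular pencil has a common kernel
vector on one side: on the right it splits off a pure C factor, on the left it leaves a single
vector on BC (`mem_fullSepCone_of_rank_le_three`). -/

/-! ### Gram factors, the boundary of the positive cone, and normal matrices. -/

theorem _root_.Matrix.PosSemidef.exists_gram {n : Type*} [Fintype n] [DecidableEq n]
    {M : Matrix n n ℂ} (hM : M.PosSemidef) :
    ∃ (V : Matrix (Fin M.rank) n ℂ) (W : Matrix n (Fin M.rank) ℂ), M = Vᴴ * V ∧ V * W = 1 := by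
  classical
  have hH := hM.isHermitian
  have hcard := hH.rank_eq_card_non_zero_eigs
  let κ := {i // hH.eigenvalues i ≠ 0}
  let s : Fin M.rank ≃ κ := Fintype.equivOfCardEq (by simp [hcard, κ])
  let U : Matrix n n ℂ := hH.eigenvectorUnitary
  have hUU : Uᴴ * U = 1 := Unitary.coe_star_mul_self _
  have hspec : M = U * Matrix.diagonal (fun i => (hH.eigenvalues i : ℂ)) * Uᴴ := by
    have := hH.spectral_theorem
    rw [Unitary.conjStarAlgAut_apply] at this
    exact this
  have hpos : ∀ i, 0 ≤ hH.eigenvalues i := hM.eigenvalues_nonneg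
  -- Only nonzero eigenvalues are kept, so the rows of V are independent and rescaled eigenvectors
  -- give the right inverse.
  refine ⟨Matrix.of fun k x => (Real.sqrt (hH.eigenvalues (s k)) : ℂ) * star (U x (s k)),
    Matrix.of fun x k => U x (s k) * ((Real.sqrt (hH.eigenvalues (s k)))⁻¹ : ℂ), ?_, ?_⟩
  · ext x y
    conv_lhs => rw [hspec]
    simp only [Matrix.mul_apply, Matrix.diagonal_apply, Matrix.conjTranspose_apply, Matrix.of_apply,
      mul_ite, mul_zero, Finset.sum_ite_eq', Finset.mem_univ, if_true]
    rw [s.sum_comp (fun k : κ => star ((Real.sqrt (hH.eigenvalues k) : ℂ) * star (U x k)) *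
      ((Real.sqrt (hH.eigenvalues k) : ℂ) * star (U y k)))]
    have h2 : ∀ i, star ((Real.sqrt (hH.eigenvalues i) : ℂ) * star (U x i)) *
      ((Real.sqrt (hH.eigenvalues i) : ℂ) * star (U y i)) =
        U x i * (hH.eigenvalues i : ℂ) * star (U y i) := by
      intro i
      have : (hH.eigenvalues i : ℂ) =
          (Real.sqrt (hH.eigenvalues i) : ℂ) * (Real.sqrt (hH.eigenvalues i) : ℂ) := by
        rw [← Complex.ofReal_mul, Real.mul_self_sqrt (hpos i)]
      rw [this]
      simp
      ring
    rw [Finset.sum_congr rfl (fun (k : κ) _ => h2 k)]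
    symm
    rw [← Finset.sum_filter_add_sum_filter_not Finset.univ (fun i => hH.eigenvalues i ≠ 0)
      (fun i => U x i * (hH.eigenvalues i : ℂ) * star (U y i)), Finset.sum_eq_zero (s := Finset.filter
        (fun i => ¬ hH.eigenvalues i ≠ 0) Finset.univ), add_zero]
    · exact (Finset.sum_subtype (Finset.univ.filter fun i => hH.eigenvalues i ≠ 0) (by simp)
        (fun i => U x i * (hH.eigenvalues i : ℂ) * star (U y i))).symm
    · intro i hi
      have : hH.eigenvalues i = 0 := by simpa using hi
      simp [this]
  · ext i j
    have h1 : (Uᴴ * U) (s i) (s j) = (1 : Matrix n n ℂ) (s i) (s j) := by rw [hUU]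
    simp only [Matrix.mul_apply, Matrix.conjTranspose_apply, Matrix.one_apply] at h1
    have hne : ∀ k : κ, (Real.sqrt (hH.eigenvalues k) : ℂ) ≠ 0 := by
      intro k
      have : 0 < hH.eigenvalues k := lt_of_le_of_ne (hpos k) (Ne.symm k.2)
      exact_mod_cast (Real.sqrt_pos.mpr this).ne'
    simp only [Matrix.mul_apply, Matrix.of_apply, Matrix.one_apply]
    have : ∀ x, (Real.sqrt (hH.eigenvalues (s i)) : ℂ) * star (U x (s i)) *
        (U x (s j) * ((Real.sqrt (hH.eigenvalues (s j)))⁻¹ : ℂ)) =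
        ((Real.sqrt (hH.eigenvalues (s i)) : ℂ) * ((Real.sqrt (hH.eigenvalues (s j)))⁻¹ : ℂ)) *
          (star (U x (s i)) * U x (s j)) := by intro x; ring
    simp only [this]
    rw [← Finset.mul_sum, h1]
    by_cases hij : i = j
    · subst hij
      simp [hne (s i)]
    · have : ((s i : κ) : n) ≠ s j := by
        intro h
        exact hij (s.injective (Subtype.ext h))
      simp [hij, this]

/-- Every v differs from W V v by an element of ker V, which Y also kills. -/
theorem eq_mul_of_ker {m n k : Type*} [Fintype m] [DecidableEq m] [Fintype n] [DecidableEq n]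
    [Fintype k] {V : Matrix k n ℂ} {W : Matrix n k ℂ} [DecidableEq k] (hVW : V * W = 1)
    {Y : Matrix m n ℂ} (h : ∀ v, V *ᵥ v = 0 → Y *ᵥ v = 0) : Y = Y * W * V := by
  apply Matrix.ext_of_mulVec_single
  intro i
  have h1 := h (Pi.single i 1 - (W * V) *ᵥ Pi.single i 1) (by
    rw [Matrix.mulVec_sub, Matrix.mulVec_mulVec, ← Matrix.mul_assoc, hVW, Matrix.one_mul, sub_self])
  rw [Matrix.mulVec_sub, sub_eq_zero] at h1
  rw [h1, Matrix.mulVec_mulVec, ← Matrix.mul_assoc]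

theorem exists_right_inverse_of_rank_eq {m n : Type*} [Fintype m] [DecidableEq m] [Fintype n]
    [DecidableEq n] {A : Matrix m n ℂ} (h : A.rank = Fintype.card m) :
    ∃ X : Matrix n m ℂ, A * X = 1 := by
  rw [← Matrix.mulVec_surjective_iff_exists_right_inverse]
  have : A.mulVecLin.range = ⊤ := by
    apply Submodule.eq_top_of_finrank_eq
    rw [Module.finrank_fintype_fun_eq_card]
    exact h
  exact LinearMap.range_eq_top.mp this

/-- By the kernel condition Y compresses to Z on the support of M, so M + tY = V*(1 + tZ)V. Since Z
has a negative eigenvalue, 1 + tZ becomes singular while still positive semidefinite. -/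
theorem exists_boundary {n : Type*} [Fintype n] [DecidableEq n] {M Y : Matrix n n ℂ}
    (hM : M.PosSemidef) (hY : Y.IsHermitian) (hneg : ¬ Y.PosSemidef)
    (hker : ∀ v, M *ᵥ v = 0 → Y *ᵥ v = 0) :
    ∃ t : ℝ, 0 < t ∧ (M + t • Y).PosSemidef ∧ (M + t • Y).rank < M.rank := by
  obtain ⟨V, W, hV, hVW⟩ := hM.exists_gram
  have hYW : Y = Y * W * V := eq_mul_of_ker hVW (fun v hv => hker v (by
    rw [hV, ← Matrix.mulVec_mulVec, hv, Matrix.mulVec_zero]))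
  have hYZ : Y = Vᴴ * (Wᴴ * Y * W) * V := by
    have h2 : Y = Vᴴ * Wᴴ * Y := by
      have := congrArg Matrix.conjTranspose hYW
      simpa [Matrix.conjTranspose_mul, hY.eq, Matrix.mul_assoc] using this
    conv_lhs => rw [hYW, h2]
    simp only [Matrix.mul_assoc]
  set Z := Wᴴ * Y * W with hZdef
  have hZ : Z.IsHermitian := Matrix.isHermitian_conjTranspose_mul_mul W hY
  have hnZ : ¬ Z.PosSemidef := fun h => hneg (by
    rw [hYZ]; exact h.conjTranspose_mul_mul_same V)
  have hne : ∃ i, hZ.eigenvalues i < 0 := by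
    by_contra! h
    exact hnZ (hZ.posSemidef_iff_eigenvalues_nonneg.mpr h)
  obtain ⟨i₀, hi₀⟩ := hne
  obtain ⟨j, -, hj⟩ := Finset.exists_min_image Finset.univ hZ.eigenvalues ⟨i₀, Finset.mem_univ _⟩
  set l := hZ.eigenvalues j
  have hl : l < 0 := lt_of_le_of_lt (hj i₀ (Finset.mem_univ _)) hi₀
  -- The largest t keeping 1 + tZ positive semidefinite: the least eigenvalue l is sent to 0.
  set t : ℝ := -l⁻¹ with ht
  have ht0 : 0 < t := by rw [ht]; exact neg_pos.mpr (inv_lt_zero.mpr hl)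
  have hsum : M + t • Y = Vᴴ * (1 + t • Z) * V := by
    conv_lhs => rw [hV, hYZ]
    rw [Matrix.mul_add, Matrix.add_mul, Matrix.mul_one, Matrix.mul_smul, Matrix.smul_mul]
  have hone : (1 + t • Z) = (hZ.eigenvectorUnitary : Matrix _ _ ℂ) *
      Matrix.diagonal (fun i => ((1 + t * hZ.eigenvalues i : ℝ) : ℂ)) *
      (hZ.eigenvectorUnitary : Matrix _ _ ℂ)ᴴ := by
    have h1 := hZ.spectral_theorem
    rw [Unitary.conjStarAlgAut_apply] at h1
    have hU : (hZ.eigenvectorUnitary : Matrix (Fin M.rank) (Fin M.rank) ℂ) *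
        (hZ.eigenvectorUnitary : Matrix (Fin M.rank) (Fin M.rank) ℂ)ᴴ = 1 :=
      Unitary.coe_mul_star_self hZ.eigenvectorUnitary
    have hd : Matrix.diagonal (fun i => ((1 + t * hZ.eigenvalues i : ℝ) : ℂ)) =
        1 + t • Matrix.diagonal (fun i => (hZ.eigenvalues i : ℂ)) := by
      ext a b
      by_cases hab : a = b
      · subst hab; simp
      · simp [hab]
    rw [hd, Matrix.mul_add, Matrix.add_mul, Matrix.mul_one, hU, Matrix.mul_smul, Matrix.smul_mul]
    conv_lhs => rw [h1]
    rfl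
  refine ⟨t, ht0, ?_, ?_⟩
  · rw [hsum]
    apply Matrix.PosSemidef.conjTranspose_mul_mul_same
    rw [hone]
    apply Matrix.PosSemidef.mul_mul_conjTranspose_same
    apply Matrix.PosSemidef.diagonal
    intro i
    have := hj i (Finset.mem_univ _)
    have h3 : 0 ≤ 1 + t * hZ.eigenvalues i := by
      have : t * l ≤ t * hZ.eigenvalues i := mul_le_mul_of_nonneg_left this ht0.le
      have h4 : t * l = -1 := by rw [ht, mul_comm]; simp [hl.ne]
      linarith
    simpa using Complex.zero_le_real.mpr h3
  · rw [hsum]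
    refine lt_of_le_of_lt ((Matrix.rank_mul_le_left _ _).trans (Matrix.rank_mul_le_right _ _)) ?_
    by_contra! hge
    have hdet : (1 + t • Z).det = 0 := by
      rw [hone, Matrix.det_mul, Matrix.det_mul, Matrix.det_diagonal]
      have : ∏ i, ((1 + t * hZ.eigenvalues i : ℝ) : ℂ) = 0 := by
        apply Finset.prod_eq_zero (Finset.mem_univ j)
        have : 1 + t * hZ.eigenvalues j = 0 := by
          change 1 + t * l = 0
          rw [ht]; simp [hl.ne]
        rw [this]; simp
      rw [this]; simp
    have hr : (1 + t • Z).rank = Fintype.card (Fin M.rank) :=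
      le_antisymm (Matrix.rank_le_card_width _) (by simpa using hge)
    obtain ⟨X, hX⟩ := exists_right_inverse_of_rank_eq hr
    have := congrArg Matrix.det hX
    rw [Matrix.det_mul, hdet] at this
    simp at this

/-- Spectral theorem for a normal matrix, by peeling off one unit eigenvector at a time from a
subspace invariant under B and B*. The count n is only an upper bound on the dimension: unused
places hold zero vectors. -/
theorem normal_resolution {k : Type*} [Fintype k] [DecidableEq k] {B : Matrix k k ℂ}
    (hB : Bᴴ * B = B * Bᴴ) (n : ℕ) :
    ∀ F : Submodule ℂ (k → ℂ), Module.finrank ℂ F ≤ n → (∀ v ∈ F, B *ᵥ v ∈ F) →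
      (∀ v ∈ F, Bᴴ *ᵥ v ∈ F) →
      ∃ (u : Fin n → k → ℂ) (μ : Fin n → ℂ), (∀ i, u i ∈ F) ∧
        (∀ v ∈ F, v = ∑ i, (star (u i) ⬝ᵥ v) • u i) ∧
        ∀ i, Bᴴ *ᵥ u i = star (μ i) • u i := by
  induction n with
  | zero =>
    intro F hF _ _
    refine ⟨0, 0, fun i => i.elim0, ?_, fun i => i.elim0⟩
    intro v hv
    have : F = ⊥ := Submodule.finrank_eq_zero.mp (by omega)
    rw [this] at hv
    simpa using hv
  | succ n ih =>
    intro F hF hB1 hB2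
    by_cases hbot : F = ⊥
    · refine ⟨0, 0, fun _ => F.zero_mem, ?_, ?_⟩
      · intro v hv
        rw [hbot] at hv
        simpa using hv
      · intro i; simp
    have : Nontrivial F := Submodule.nontrivial_iff_ne_bot.mpr hbot
    obtain ⟨μ, hμ⟩ := Module.End.exists_eigenvalue
      ((B.mulVecLin).restrict (p := F) (q := F) hB1)
    obtain ⟨y, hy⟩ := hμ.exists_hasEigenvector
    have hyB : B *ᵥ (y : k → ℂ) = μ • (y : k → ℂ) := by
      exact congrArg Subtype.val hy.apply_eq_smul
    have hy0 : (y : k → ℂ) ≠ 0 := by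
      intro h; exact hy.2 (Subtype.ext h)
    have hyBs : Bᴴ *ᵥ (y : k → ℂ) = star μ • (y : k → ℂ) := by
      set C : Matrix k k ℂ := B - μ • 1 with hC
      have hCn : C * Cᴴ = Cᴴ * C := by
        simp only [hC, Matrix.conjTranspose_sub, Matrix.conjTranspose_smul,
          Matrix.conjTranspose_one, Matrix.mul_sub, Matrix.sub_mul, hB, Matrix.smul_mul,
          Matrix.mul_smul, Matrix.one_mul, Matrix.mul_one]
        module
      have h0 : C *ᵥ (y : k → ℂ) = 0 := by
        rw [hC, Matrix.sub_mulVec, hyB, Matrix.smul_mulVec, Matrix.one_mulVec, sub_self]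
      have h1 : Cᴴ *ᵥ (y : k → ℂ) = 0 := by
        rw [← dotProduct_star_self_eq_zero, Matrix.star_mulVec, Matrix.conjTranspose_conjTranspose,
          ← Matrix.dotProduct_mulVec, Matrix.mulVec_mulVec, hCn, ← Matrix.mulVec_mulVec, h0,
          Matrix.mulVec_zero, dotProduct_zero]
      rw [hC, Matrix.conjTranspose_sub, Matrix.sub_mulVec, Matrix.conjTranspose_smul,
        Matrix.smul_mulVec, Matrix.conjTranspose_one, Matrix.one_mulVec, sub_eq_zero] at h1
      exact h1
    have hpos : 0 < star (y : k → ℂ) ⬝ᵥ (y : k → ℂ) := Matrix.dotProduct_star_self_pos_iff.mpr hy0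
    obtain ⟨c, hc0, hc⟩ : ∃ c : ℝ, 0 < c ∧ star (y : k → ℂ) ⬝ᵥ (y : k → ℂ) = c := by
      obtain ⟨h1, h2⟩ := Complex.lt_def.mp hpos
      exact ⟨_, h1, Complex.ext rfl (by simpa using h2.symm)⟩
    set s : ℂ := (((Real.sqrt c)⁻¹ : ℝ) : ℂ) with hs
    have hss : star s * s * c = 1 := by
      have : star s = s := by simp [hs]
      rw [this, hs, ← Complex.ofReal_mul, ← mul_inv, Real.mul_self_sqrt hc0.le, ← Complex.ofReal_mul,
        inv_mul_cancel₀ hc0.ne', Complex.ofReal_one]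
    set x : k → ℂ := s • (y : k → ℂ) with hx
    have hxF : x ∈ F := F.smul_mem _ y.2
    have hxx : star x ⬝ᵥ x = 1 := by
      rw [hx, star_smul, smul_dotProduct, dotProduct_smul, hc, smul_eq_mul, smul_eq_mul, ← mul_assoc,
        hss]
    have hxB : B *ᵥ x = μ • x := by rw [hx, Matrix.mulVec_smul, hyB, smul_comm]
    have hxBs : Bᴴ *ᵥ x = star μ • x := by rw [hx, Matrix.mulVec_smul, hyBs, smul_comm]
    let ℓ : (k → ℂ) →ₗ[ℂ] ℂ :=
      { toFun := fun v => star x ⬝ᵥ v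
        map_add' := fun _ _ => dotProduct_add _ _ _
        map_smul' := fun _ _ => dotProduct_smul _ _ _ }
    have hlB : ∀ v, star x ⬝ᵥ (B *ᵥ v) = μ * (star x ⬝ᵥ v) := by
      intro v
      have h1 := Matrix.star_mulVec Bᴴ x
      rw [Matrix.conjTranspose_conjTranspose] at h1
      rw [Matrix.dotProduct_mulVec, ← h1, hxBs, star_smul, star_star, smul_dotProduct, smul_eq_mul]
    have hlBs : ∀ v, star x ⬝ᵥ (Bᴴ *ᵥ v) = star μ * (star x ⬝ᵥ v) := by
      intro v
      rw [Matrix.dotProduct_mulVec, ← Matrix.star_mulVec, hxB, star_smul, smul_dotProduct,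
        smul_eq_mul]
    have hlt : F ⊓ LinearMap.ker ℓ < F := by
      refine lt_of_le_of_ne inf_le_left (fun h => ?_)
      have h1 : x ∈ F ⊓ LinearMap.ker ℓ := by rw [h]; exact hxF
      have h2 : star x ⬝ᵥ x = 0 := h1.2
      rw [hxx] at h2
      exact one_ne_zero h2
    obtain ⟨u, ν, huF, hu, hν⟩ := ih (F ⊓ LinearMap.ker ℓ)
      (by have := Submodule.finrank_lt_finrank_of_lt hlt; omega)
      (fun v hv => ⟨hB1 v hv.1, by
        have : star x ⬝ᵥ v = 0 := hv.2
        change star x ⬝ᵥ (B *ᵥ v) = 0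
        rw [hlB, this, mul_zero]⟩)
      (fun v hv => ⟨hB2 v hv.1, by
        have : star x ⬝ᵥ v = 0 := hv.2
        change star x ⬝ᵥ (Bᴴ *ᵥ v) = 0
        rw [hlBs, this, mul_zero]⟩)
    refine ⟨Fin.cons x u, Fin.cons μ ν, ?_, ?_, ?_⟩
    · intro i
      refine Fin.cases hxF (fun j => (huF j).1) i
    · intro v hv
      have hv' : v - (star x ⬝ᵥ v) • x ∈ F ⊓ LinearMap.ker ℓ := by
        refine ⟨F.sub_mem hv (F.smul_mem _ hxF), ?_⟩
        change star x ⬝ᵥ (v - (star x ⬝ᵥ v) • x) = 0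
        rw [dotProduct_sub, dotProduct_smul, hxx, smul_eq_mul, mul_one, sub_self]
      have h1 := hu _ hv'
      have h2 : ∀ i, star (u i) ⬝ᵥ x = 0 := by
        intro i
        have h3 : star x ⬝ᵥ u i = 0 := (huF i).2
        have := congrArg star h3
        rwa [← Matrix.star_dotProduct_star, star_star, star_zero] at this
      rw [Fin.sum_univ_succ]
      simp only [Fin.cons_zero, Fin.cons_succ]
      simp only [dotProduct_sub, dotProduct_smul, h2, smul_zero, sub_zero] at h1
      rw [← h1]
      abel
    · intro i
      refine Fin.cases hxBs (fun j => hν j) i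

/-- The product vector `e ⊗ f`. -/
def prodVec {α β : Type*} (e : α → ℂ) (f : β → ℂ) : α × β → ℂ := fun x => e x.1 * f x.2

/-- Partial transpose of a bipartite operator with respect to the left party. -/
def ptL {α β : Type*} (ρ : Matrix (α × β) (α × β) ℂ) : Matrix (α × β) (α × β) ℂ :=
  Matrix.of fun x y => ρ (y.1, x.2) (x.1, y.2)

/-- The insertion `h ↦ x ⊗ h` of a fixed vector on the left party. -/
def insL {α : Type*} (β : Type*) [DecidableEq β] (x : α → ℂ) : Matrix (α × β) β ℂ :=
  Matrix.of fun p s => x p.1 * (1 : Matrix β β ℂ) p.2 s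

theorem insL_add {α β : Type*} [DecidableEq β] (x y : α → ℂ) :
    insL β (x + y) = insL β x + insL β y := by
  ext p s; simp [insL, add_mul]

theorem insL_smul {α β : Type*} [DecidableEq β] (c : ℂ) (x : α → ℂ) :
    insL β (c • x) = c • insL β x := by
  ext p s; simp [insL, mul_assoc]

theorem _root_.Matrix.PosSemidef.mul_eq_zero_of_conj {n m : Type*} [Fintype n] [DecidableEq n]
    [Fintype m] {M : Matrix n n ℂ} (hM : M.PosSemidef) {H : Matrix n m ℂ} (h : Hᴴ * M * H = 0) :
    M * H = 0 := by
  obtain ⟨V, W, hV, -⟩ := hM.exists_gram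
  have h1 : (V * H)ᴴ * (V * H) = 0 := by
    rw [← h, Matrix.conjTranspose_mul, Matrix.mul_assoc, ← Matrix.mul_assoc Vᴴ, ← hV,
      Matrix.mul_assoc]
  rw [Matrix.conjTranspose_mul_self_eq_zero] at h1
  calc M * H = Vᴴ * V * H := by rw [← hV]
    _ = 0 := by rw [Matrix.mul_assoc, h1, Matrix.mul_zero]

/-! ### Positivity of the partial transpose in terms of slices. -/

section Slices

variable {α β γ κ : Type*} [Fintype α] [Fintype β] [DecidableEq β]

theorem mul_insL_apply (T : Matrix γ (α × β) ℂ) (x : α → ℂ) (k : γ) (s : β) :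
    (T * insL β x) k s = ∑ a, T k (a, s) * x a := by
  simp only [Matrix.mul_apply, insL, Matrix.of_apply, Fintype.sum_prod_type, Matrix.one_apply]
  simp

theorem insL_conj_apply (ρ : Matrix (α × β) (α × β) ℂ) (x y : α → ℂ) (s t : β) :
    ((insL β y)ᴴ * ρ * insL β x) s t = ∑ a, ∑ a', star (y a') * ρ (a', s) (a, t) * x a := by
  rw [mul_insL_apply]
  refine Finset.sum_congr rfl fun a _ => ?_
  rw [← Finset.sum_mul]
  congr 1
  simp only [Matrix.mul_apply, insL, Matrix.of_apply, Fintype.sum_prod_type, Matrix.one_apply,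
    Matrix.conjTranspose_apply]
  simp [apply_ite]

/-- Transposing the left party exchanges the bra and ket vectors there, up to conjugation. This is
how the partial transpose reaches the slices. -/
theorem insL_conj_ptL (ρ : Matrix (α × β) (α × β) ℂ) (x y : α → ℂ) :
    (insL β (star x))ᴴ * ptL ρ * insL β (star y) = (insL β y)ᴴ * ρ * insL β x := by
  ext s t
  rw [insL_conj_apply, insL_conj_apply, Finset.sum_comm]
  refine Finset.sum_congr rfl fun a _ => Finset.sum_congr rfl fun a' _ => ?_
  simp only [ptL, Matrix.of_apply, Pi.star_apply, star_star]
  ring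

variable [Fintype κ] {T : Matrix κ (α × β) ℂ} {ρ : Matrix (α × β) (α × β) ℂ}

theorem insL_conj_gram (hρ : ρ = Tᴴ * T) (x y : α → ℂ) :
    (insL β (star x))ᴴ * ptL ρ * insL β (star y) = (T * insL β y)ᴴ * (T * insL β x) := by
  rw [insL_conj_ptL, hρ, Matrix.conjTranspose_mul]
  simp only [Matrix.mul_assoc]

theorem insL_conj_gram' (hρ : ρ = Tᴴ * T) {m l : Type*} [Fintype m] [Fintype l] (x y : α → ℂ)
    (C : Matrix β m ℂ) (D : Matrix β l ℂ) :
    (insL β (star x) * C)ᴴ * ptL ρ * (insL β (star y) * D) =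
      (T * insL β y * C)ᴴ * (T * insL β x * D) := by
  calc _ = Cᴴ * ((insL β (star x))ᴴ * ptL ρ * insL β (star y)) * D := by
        rw [Matrix.conjTranspose_mul]; simp only [Matrix.mul_assoc]
    _ = _ := by
        rw [insL_conj_gram hρ, Matrix.conjTranspose_mul (T * insL β y)]
        simp only [Matrix.mul_assoc]

/-- The range of the slice along `x` is orthogonal to the image under any other slice of the kernel
of the slice along `x`. -/
theorem slice_orthogonal [DecidableEq α] (hρ : ρ = Tᴴ * T) (hpt : (ptL ρ).PosSemidef) {m : Type*} [Fintype m]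
    (x y : α → ℂ) {H : Matrix β m ℂ} (hH : T * insL β x * H = 0) :
    (T * insL β x)ᴴ * (T * insL β y * H) = 0 := by
  -- The expectation of ρ^Γ on x̄ ⊗ H is (T_x H)*(T_x H) = 0, and a positive operator kills vectors
  -- of zero expectation.
  have h1 : ptL ρ * (insL β (star x) * H) = 0 := by
    apply hpt.mul_eq_zero_of_conj
    rw [insL_conj_gram' hρ, hH, Matrix.mul_zero]
  have h2 := insL_conj_gram hρ y x
  calc _ = ((insL β (star y))ᴴ * ptL ρ * insL β (star x)) * H := by
          rw [h2]; simp only [Matrix.mul_assoc]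
    _ = (insL β (star y))ᴴ * (ptL ρ * (insL β (star x) * H)) := by simp only [Matrix.mul_assoc]
    _ = 0 := by rw [h1, Matrix.mul_zero]

variable [DecidableEq κ]

/-- The columns of 1 - W T_x lie in ker T_x, so their images under T_y are orthogonal to range T_x,
which is the whole space. -/
theorem slice_eq_mul [DecidableEq α] (hρ : ρ = Tᴴ * T) (hpt : (ptL ρ).PosSemidef) {x : α → ℂ} {W : Matrix β κ ℂ}
    (hW : T * insL β x * W = 1) (y : α → ℂ) :
    T * insL β y = (T * insL β y * W) * (T * insL β x) := by
  have h1 := slice_orthogonal hρ hpt x y (H := 1 - W * (T * insL β x)) (by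
    rw [Matrix.mul_sub, Matrix.mul_one, ← Matrix.mul_assoc, hW, Matrix.one_mul, sub_self])
  have h2 := congrArg (fun X => Wᴴ * X) h1
  simp only [Matrix.mul_zero] at h2
  rw [← Matrix.mul_assoc, ← Matrix.conjTranspose_mul, hW, Matrix.conjTranspose_one, Matrix.one_mul,
    Matrix.mul_sub, Matrix.mul_one, sub_eq_zero, ← Matrix.mul_assoc] at h2
  exact h2

/-- Testing ρ^Γ on ȳ ⊗ W - x̄ ⊗ W B* gives B*B - BB* ≥ 0. Its trace vanishes, hence so does it. -/
theorem slice_normal (hρ : ρ = Tᴴ * T) (hpt : (ptL ρ).PosSemidef) {x : α → ℂ} {W : Matrix β κ ℂ}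
    (hW : T * insL β x * W = 1) (y : α → ℂ) :
    (T * insL β y * W)ᴴ * (T * insL β y * W) = (T * insL β y * W) * (T * insL β y * W)ᴴ := by
  set B := T * insL β y * W with hB
  have h1 := hpt.conjTranspose_mul_mul_same (insL β (star y) * W - insL β (star x) * (W * Bᴴ))
  have h2 : (insL β (star y) * W - insL β (star x) * (W * Bᴴ))ᴴ * ptL ρ *
      (insL β (star y) * W - insL β (star x) * (W * Bᴴ)) = Bᴴ * B - B * Bᴴ := by
    rw [Matrix.conjTranspose_sub, Matrix.sub_mul, Matrix.sub_mul, Matrix.mul_sub, Matrix.mul_sub]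
    simp only [insL_conj_gram' hρ]
    simp only [← Matrix.mul_assoc, hW, ← hB, Matrix.one_mul, Matrix.conjTranspose_one,
      Matrix.conjTranspose_mul, Matrix.conjTranspose_conjTranspose, Matrix.mul_one]
    abel
  rw [h2] at h1
  have h3 : (Bᴴ * B - B * Bᴴ).trace = 0 := by
    rw [Matrix.trace_sub, Matrix.trace_mul_comm, sub_self]
  exact sub_eq_zero.mp (h1.trace_eq_zero_iff.mp h3)

end Slices

/-! ### Product vectors from a slice of full rank. -/

theorem gram_eq_sum_proj {n k κ : Type*} [Fintype n] [Fintype k] [DecidableEq k] [Fintype κ]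
    (T : Matrix k n ℂ) (u : κ → k → ℂ) (hu : ∀ v : k → ℂ, v = ∑ i, (star (u i) ⬝ᵥ v) • u i) :
    Tᴴ * T = ∑ i, proj (star (star (u i) ᵥ* T)) := by
  ext x y
  have h1 : (Tᴴ * T) x y = star (T.col x) ⬝ᵥ (T.col y) := by
    simp [Matrix.mul_apply, dotProduct, Matrix.col_apply]
  rw [h1]
  conv_lhs => rw [hu (T.col y)]
  rw [dotProduct_sum, Matrix.sum_apply]
  refine Finset.sum_congr rfl fun i _ => ?_
  simp only [proj, Matrix.vecMulVec_apply, star_star, Pi.star_apply, Matrix.vecMul,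
    dotProduct_smul, smul_eq_mul]
  rw [mul_comm]
  congr 1
  rw [← Matrix.star_dotProduct_star, star_star]
  rfl

/-- A bipartite PPT operator `Tᴴ * T` on `ℂ² ⊗ ℂ^β` with a slice of full rank is a sum of at most
rank many product projectors. -/
theorem exists_product_decomposition {β κ : Type*} [Fintype β] [DecidableEq β] [Fintype κ]
    [DecidableEq κ] {n : ℕ} (hn : Fintype.card κ ≤ n) {T : Matrix κ (Fin 2 × β) ℂ}
    {ρ : Matrix (Fin 2 × β) (Fin 2 × β) ℂ} (hρ : ρ = Tᴴ * T) (hpt : (ptL ρ).PosSemidef)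
    {x : Fin 2 → ℂ} (hx : x ≠ 0) {W : Matrix β κ ℂ} (hW : T * insL β x * W = 1) :
    ∃ (e : Fin n → Fin 2 → ℂ) (φ : Fin n → β → ℂ), (∀ i, e i ≠ 0) ∧
      ρ = ∑ i, proj (prodVec (e i) (φ i)) := by
  obtain ⟨p, q, rfl⟩ : ∃ p q, x = ![p, q] := ⟨x 0, x 1, by ext i; fin_cases i <;> rfl⟩
  -- A vector orthogonal to x of the same length, so that x and y determine all slices.
  set y : Fin 2 → ℂ := ![-star q, star p] with hy
  have hB := slice_normal hρ hpt hW y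
  have hslice := slice_eq_mul hρ hpt hW y
  set B := T * insL β y * W
  obtain ⟨u, μ, -, hu, hμ⟩ := normal_resolution hB n ⊤ (by simpa using hn) (by simp) (by simp)
  have hD : star p * p + star q * q ≠ 0 := by
    intro h
    have h1 : star ![p, q] ⬝ᵥ ![p, q] = 0 := by simpa [dotProduct, Fin.sum_univ_two] using h
    exact hx (dotProduct_star_self_eq_zero.mp h1)
  set D := star p * p + star q * q with hDdef
  let φ : Fin n → β → ℂ := fun i => D⁻¹ • star (star (u i) ᵥ* (T * insL β ![p, q]))
  -- This is x + μ̄ᵢ y. The row uᵢ*T has y-component μᵢ times its x-component, so its conjugate is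
  -- (x + μ̄ᵢ y) ⊗ φᵢ, with D = ‖x‖² as normalisation. Pairing with x gives D ≠ 0, so eᵢ ≠ 0 even
  -- for padded uᵢ.
  let e : Fin n → Fin 2 → ℂ := fun i => ![p - star (q * μ i), q + star (p * μ i)]
  refine ⟨e, φ, ?_, ?_⟩
  · intro i hi
    have h0 := congrFun hi 0
    have h1 := congrFun hi 1
    simp only [e, Matrix.cons_val_zero, Matrix.cons_val_one, Pi.zero_apply, star_mul] at h0 h1
    apply hD
    linear_combination star p * h0 + star q * h1
  · rw [hρ, gram_eq_sum_proj T u (fun v => hu v trivial)]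
    refine Finset.sum_congr rfl fun i _ => ?_
    congr 1
    have hrow : star (u i) ᵥ* (T * insL β y) = μ i • (star (u i) ᵥ* (T * insL β ![p, q])) := by
      rw [hslice, ← Matrix.vecMul_vecMul]
      have := congrArg star (hμ i)
      rw [Matrix.star_mulVec, Matrix.conjTranspose_conjTranspose, star_smul, star_star] at this
      rw [this, Matrix.smul_vecMul]
    ext ⟨a, s⟩
    have hexp : ∀ z : Fin 2 → ℂ, (star (u i) ᵥ* (T * insL β z)) s =
        z 0 * (star (u i) ᵥ* T) (0, s) + z 1 * (star (u i) ᵥ* T) (1, s) := by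
      intro z
      rw [← Matrix.vecMul_vecMul]
      simp only [Matrix.vecMul, dotProduct, insL, Matrix.of_apply, Fintype.sum_prod_type,
        Fin.sum_univ_two, Matrix.one_apply]
      simp [mul_comm]
    have h1 := congrFun hrow s
    rw [Pi.smul_apply, smul_eq_mul, hexp, hexp] at h1
    simp only [hy, Matrix.cons_val_zero, Matrix.cons_val_one] at h1
    simp only [prodVec, φ, e, Pi.smul_apply, Pi.star_apply, hexp, smul_eq_mul, Matrix.cons_val_zero,
      Matrix.cons_val_one]
    generalize (star (u i) ᵥ* T) = v at *
    have h2 := congrArg star h1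
    simp only [star_add, star_mul, star_neg, star_star] at h2
    rw [mul_left_comm, eq_inv_mul_iff_mul_eq₀ hD, hDdef]
    fin_cases a
    · simp [star_add, star_mul] at h2 ⊢
      linear_combination -(starRingEnd ℂ) q * h2
    · simp [star_add, star_mul] at h2 ⊢
      linear_combination (starRingEnd ℂ) p * h2

/-! ### Slices of deficient rank. -/

theorem _root_.Matrix.exists_rank_factorization {m n : Type*} [Fintype m] [DecidableEq m]
    [Fintype n] [DecidableEq n] (A : Matrix m n ℂ) {r : ℕ} (hr : A.rank ≤ r) :
    ∃ (Q : Matrix (Fin r) n ℂ) (R : Matrix n (Fin r) ℂ), A * R * Q = A := by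
  classical
  set L := A.mulVecLin with hL
  let e : LinearMap.range L ≃ₗ[ℂ] (Fin A.rank → ℂ) :=
    LinearEquiv.ofFinrankEq _ _ (by rw [Module.finrank_fin_fun]; rfl)
  let q : (n → ℂ) →ₗ[ℂ] (Fin A.rank → ℂ) := e.toLinearMap ∘ₗ L.rangeRestrict
  have hq : LinearMap.range q = ⊤ := by
    rw [LinearMap.range_eq_top]
    exact e.surjective.comp L.surjective_rangeRestrict
  obtain ⟨g, hg⟩ := q.exists_rightInverse_of_surjective hq
  have hker : ∀ v, q v = 0 → L v = 0 := by
    intro v hv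
    have : L.rangeRestrict v = 0 := e.injective (by rw [map_zero]; exact hv)
    exact congrArg Subtype.val this
  have hLg : ∀ v, L (g (q v)) = L v := by
    intro v
    rw [← sub_eq_zero, ← map_sub]
    apply hker
    rw [map_sub]
    have := LinearMap.congr_fun hg (q v)
    simp only [LinearMap.comp_apply, LinearMap.id_apply] at this
    rw [this, sub_self]
  -- Zero padding from the actual rank up to the bound r.
  let J : Matrix (Fin r) (Fin A.rank) ℂ := Matrix.of fun i j => if i = Fin.castLE hr j then 1 else 0
  have hJ : Jᵀ * J = 1 := by
    ext i j
    simp only [Matrix.mul_apply, Matrix.transpose_apply, J, Matrix.of_apply, Matrix.one_apply]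
    simp [eq_comm]
  refine ⟨J * LinearMap.toMatrix' q, LinearMap.toMatrix' g * Jᵀ, ?_⟩
  calc _ = A * LinearMap.toMatrix' g * (Jᵀ * J) * LinearMap.toMatrix' q := by
        simp only [Matrix.mul_assoc]
    _ = A * (LinearMap.toMatrix' g * LinearMap.toMatrix' q) := by
        rw [hJ, Matrix.mul_one, Matrix.mul_assoc]
    _ = A := by
        rw [← LinearMap.toMatrix'_comp]
        apply Matrix.ext_of_mulVec_single
        intro i
        rw [← Matrix.mulVec_mulVec, LinearMap.toMatrix'_mulVec]
        exact hLg _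

/-- If all slices of a bipartite PPT operator `Tᴴ * T` have rank at most `r`, then they all factor
through the same `r`-dimensional space. -/
theorem slice_factorization {α β κ : Type*} [Fintype α] [DecidableEq α] [Fintype β] [DecidableEq β]
    [Fintype κ] [DecidableEq κ] {T : Matrix κ (α × β) ℂ} {ρ : Matrix (α × β) (α × β) ℂ}
    (hρ : ρ = Tᴴ * T) (hpt : (ptL ρ).PosSemidef) {r : ℕ}
    (hr : ∀ x : α → ℂ, (T * insL β x).rank ≤ r) :
    ∃ (Q : Matrix (Fin r) β ℂ) (S : α → Matrix κ (Fin r) ℂ),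
      ∀ k a s, T k (a, s) = (S a * Q) k s := by
  obtain ⟨x, hmax⟩ : ∃ x : α → ℂ, ∀ y : α → ℂ, (T * insL β y).rank ≤ (T * insL β x).rank := by
    have hfin : (Set.range fun x : α → ℂ => (T * insL β x).rank).Finite :=
      (Set.finite_Iic r).subset (by rintro _ ⟨x, rfl⟩; exact hr x)
    obtain ⟨_, ⟨x, rfl⟩, hx⟩ := Set.exists_max_image _ id hfin ⟨_, 0, rfl⟩
    exact ⟨x, fun y => hx _ ⟨y, rfl⟩⟩
  -- Maximality of the rank at x makes ker T_x lie in every ker T_y. Otherwise w = T_y h is nonzero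
  -- and orthogonal to range T_x; for small t ≠ 0 the range of T_{x+ty} contains w and a perturbed
  -- basis of range T_x, so the rank increases.
  have hker : ∀ (y : α → ℂ) (h : β → ℂ), (T * insL β x) *ᵥ h = 0 → (T * insL β y) *ᵥ h = 0 := by
    intro y h hh
    set w := (T * insL β y) *ᵥ h with hw
    by_contra hw0
    set L := (T * insL β x).mulVecLin with hL
    have horth : ∀ v, star (L v) ⬝ᵥ w = 0 := by
      intro v
      have h1 := slice_orthogonal hρ hpt x y (H := Matrix.replicateCol Unit h) (by
        ext i j
        exact congrFun hh i)
      have h2 : (T * insL β x)ᴴ *ᵥ w = 0 := by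
        ext i
        exact congrFun (congrFun h1 i) ()
      rw [hL, Matrix.mulVecLin_apply, Matrix.star_mulVec, ← Matrix.dotProduct_mulVec, h2,
        dotProduct_zero]
    let m := (T * insL β x).rank
    let b : Module.Basis (Fin m) ℂ (LinearMap.range L) := Module.finBasisOfFinrankEq _ _ rfl
    choose p hp using fun i => (b i).2
    let f : ℂ → Option (Fin m) → κ → ℂ := fun t o =>
      o.elim w (fun i => L (p i) + t • (T * insL β y) *ᵥ (p i))
    have hf0 : LinearIndependent ℂ (f 0) := by
      rw [linearIndependent_option]
      have hsome : f 0 ∘ (some : Fin m → Option (Fin m)) = fun i => ((b i : LinearMap.range L) : κ → ℂ) := by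
        funext i
        simp [f, hp]
      refine ⟨?_, ?_⟩
      · have := b.linearIndependent.map' (LinearMap.range L).subtype (Submodule.ker_subtype _)
        rw [hsome]
        exact this
      · rw [hsome]
        intro hmem
        have hsub : Submodule.span ℂ (Set.range fun i => ((b i : LinearMap.range L) : κ → ℂ)) ≤
            LinearMap.range L := by
          rw [Submodule.span_le]
          rintro _ ⟨i, rfl⟩
          exact (b i).2
        obtain ⟨v, hv⟩ := hsub hmem
        have h1 := horth v
        rw [hv] at h1
        exact hw0 (dotProduct_star_self_eq_zero.mp h1)
    have hcont : Continuous f := by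
      refine continuous_pi fun o => ?_
      cases o with
      | none => exact continuous_const
      | some i => exact continuous_const.add (continuous_id.smul continuous_const)
    have hopen := (isOpen_setOfPred_linearIndependent (𝕜 := ℂ) (E := κ → ℂ)
      (ι := Option (Fin m))).preimage hcont
    have hev : ∀ᶠ t in nhds (0 : ℂ), LinearIndependent ℂ (f t) := hopen.mem_nhds hf0
    obtain ⟨t, ht, ht0⟩ := ((hev.filter_mono nhdsWithin_le_nhds).and
      (self_mem_nhdsWithin (a := (0 : ℂ)) (s := {0}ᶜ))).exists
    have hrange : ∀ o, f t o ∈ LinearMap.range (T * insL β (x + t • y)).mulVecLin := by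
      have hexp : ∀ v, (T * insL β (x + t • y)).mulVecLin v = L v + t • (T * insL β y) *ᵥ v := by
        intro v
        rw [insL_add, insL_smul, Matrix.mul_add, Matrix.mul_smul, Matrix.mulVecLin_apply,
          Matrix.add_mulVec, Matrix.smul_mulVec]
        rfl
      intro o
      cases o with
      | none =>
        refine ⟨t⁻¹ • h, ?_⟩
        rw [hexp]
        have : L (t⁻¹ • h) = 0 := by rw [map_smul]; simp [hL, hh]
        rw [this, Matrix.mulVec_smul, smul_smul, mul_inv_cancel₀ ht0, one_smul, zero_add]
        rfl
      | some i => exact ⟨p i, hexp _⟩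
    have hspan : Submodule.span ℂ (Set.range (f t)) ≤
        LinearMap.range (T * insL β (x + t • y)).mulVecLin := by
      rw [Submodule.span_le]
      rintro _ ⟨o, rfl⟩
      exact hrange o
    have h1 := Submodule.finrank_mono hspan
    rw [finrank_span_eq_card ht, Fintype.card_option, Fintype.card_fin] at h1
    have h2 := hmax (x + t • y)
    change m + 1 ≤ (T * insL β (x + t • y)).rank at h1
    change _ ≤ m at h2
    omega
  obtain ⟨Q, R, hQR⟩ := (T * insL β x).exists_rank_factorization (hr x)
  refine ⟨Q, fun a => T * insL β (Pi.single a 1) * R, ?_⟩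
  intro k a s
  have h1 : (T * insL β (Pi.single a 1)) k s = T k (a, s) := by
    rw [mul_insL_apply]
    simp [Pi.single_apply]
  rw [← h1]
  have h2 := hker (Pi.single a 1) (Pi.single s 1 - (R * Q) *ᵥ Pi.single s 1) (by
    rw [Matrix.mulVec_sub, Matrix.mulVec_mulVec, ← Matrix.mul_assoc, hQR, sub_self])
  rw [Matrix.mulVec_sub, Matrix.mulVec_mulVec, ← Matrix.mul_assoc, sub_eq_zero] at h2
  have h3 := congrFun h2 k
  simpa only [Matrix.mulVec_single_one, Matrix.col_apply] using h3

/-- The cone generated by the product projectors of a bipartite system. -/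
def sepCone (α β : Type*) : AddSubmonoid (Matrix (α × β) (α × β) ℂ) :=
  AddSubmonoid.closure {M | ∃ (e : α → ℂ) (f : β → ℂ), M = proj (prodVec e f)}

/-! ### The bipartite separable cone. -/

section Proj

variable {α β n κ : Type*}

theorem proj_smul (c : ℂ) (v : n → ℂ) : proj (c • v) = (star c * c) • proj v := by
  ext i j
  simp only [proj, Matrix.vecMulVec_apply, Pi.star_apply, Pi.smul_apply, smul_eq_mul, star_mul,
    Matrix.smul_apply]
  ring

theorem smul_proj {c : ℝ} (hc : 0 ≤ c) (v : n → ℂ) :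
    c • proj v = proj ((Real.sqrt c : ℂ) • v) := by
  rw [proj_smul]
  have : star (Real.sqrt c : ℂ) * (Real.sqrt c : ℂ) = c := by
    rw [Complex.star_def, Complex.conj_ofReal, ← Complex.ofReal_mul, Real.mul_self_sqrt hc]
  rw [this]
  rfl

theorem gram_eq_sum_rows [Fintype κ] (T : Matrix κ n ℂ) : Tᴴ * T = ∑ k, proj (star (T k)) := by
  ext i j
  simp [Matrix.mul_apply, Matrix.sum_apply, proj, Matrix.vecMulVec_apply]

theorem smul_prodVec (c : ℂ) (e : α → ℂ) (f : β → ℂ) :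
    c • prodVec e f = prodVec (c • e) f := by
  ext x; simp [prodVec, mul_assoc]

theorem prodVec_smul (c : ℂ) (e : α → ℂ) (f : β → ℂ) :
    prodVec e (c • f) = c • prodVec e f := by
  ext x; simp [prodVec, mul_left_comm]

theorem proj_prodVec_mem (e : α → ℂ) (f : β → ℂ) : proj (prodVec e f) ∈ sepCone α β :=
  AddSubmonoid.subset_closure ⟨e, f, rfl⟩

theorem smul_mem_sepCone {c : ℝ} (hc : 0 ≤ c) {M : Matrix (α × β) (α × β) ℂ}
    (hM : M ∈ sepCone α β) : c • M ∈ sepCone α β := by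
  induction hM using AddSubmonoid.closure_induction with
  | mem x hx =>
    obtain ⟨e, f, rfl⟩ := hx
    rw [smul_proj hc, smul_prodVec]
    exact proj_prodVec_mem _ _
  | zero => rw [smul_zero]; exact zero_mem _
  | add x y _ _ hx hy => rw [smul_add]; exact add_mem hx hy

theorem ptL_add (M N : Matrix (α × β) (α × β) ℂ) : ptL (M + N) = ptL M + ptL N := rfl

theorem ptL_smul (c : ℝ) (M : Matrix (α × β) (α × β) ℂ) : ptL (c • M) = c • ptL M := rfl

theorem ptL_isHermitian {M : Matrix (α × β) (α × β) ℂ} (hM : M.IsHermitian) :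
    (ptL M).IsHermitian := by
  ext x y
  exact hM.apply _ _

theorem ptL_mem_sepCone {M : Matrix (α × β) (α × β) ℂ} (hM : M ∈ sepCone α β) :
    ptL M ∈ sepCone α β := by
  induction hM using AddSubmonoid.closure_induction with
  | mem x hx =>
    obtain ⟨e, f, rfl⟩ := hx
    have : ptL (proj (prodVec e f)) = proj (prodVec (star e) f) := by
      ext x y
      simp only [ptL, proj, prodVec, Matrix.vecMulVec_apply, Matrix.of_apply, Pi.star_apply,
        star_mul, star_star]
      ring
    rw [this]
    exact proj_prodVec_mem _ _
  | zero => exact zero_mem _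
  | add x y _ _ hx hy => rw [ptL_add]; exact add_mem hx hy

/-- The dichotomy for bipartite PPT operators on `ℂ² ⊗ ℂ^β`: either a slice of a Gram factor has
full rank, and the operator is a sum of product projectors, or all slices factor through a space of
smaller dimension. -/
theorem product_decomposition_or_factorization [Fintype β] [DecidableEq β] {n : ℕ} {k : ℕ}
    (hk : k ≤ n + 1) {T : Matrix (Fin k) (Fin 2 × β) ℂ} {ρ : Matrix (Fin 2 × β) (Fin 2 × β) ℂ}
    (hρ : ρ = Tᴴ * T) (hpt : (ptL ρ).PosSemidef) :
    (∃ (e : Fin (n + 1) → Fin 2 → ℂ) (φ : Fin (n + 1) → β → ℂ), (∀ i, e i ≠ 0) ∧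
      ρ = ∑ i, proj (prodVec (e i) (φ i))) ∨
    ∃ (Q : Matrix (Fin n) β ℂ) (S : Fin 2 → Matrix (Fin k) (Fin n) ℂ),
      ∀ j a s, T j (a, s) = (S a * Q) j s := by
  by_cases hfull : ∃ x : Fin 2 → ℂ, x ≠ 0 ∧ (T * insL β x).rank = k
  · left
    obtain ⟨x, hx0, hx⟩ := hfull
    obtain ⟨W, hW⟩ := exists_right_inverse_of_rank_eq (A := T * insL β x) (by simpa using hx)
    exact exists_product_decomposition (by simpa using hk) hρ hpt hx0 hW
  · right
    apply slice_factorization hρ hpt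
    intro x
    by_cases hx : x = 0
    · have : insL β x = 0 := by subst hx; ext; simp [insL]
      rw [this, Matrix.mul_zero, Matrix.rank_zero]
      exact Nat.zero_le _
    · have h1 : (T * insL β x).rank ≤ k := by
        simpa using Matrix.rank_le_card_height (T * insL β x)
      have h2 : (T * insL β x).rank ≠ k := fun h => hfull ⟨x, hx, h⟩
      omega

end Proj

/-! ### Two qubits: positive partial transpose implies separability. -/

section TwoQubits

/-- In the deficient case all slices factor through one dimension, which makes every row of T a
product. -/
theorem mem_sepCone_of_rank_le_two {β : Type*} [Fintype β] [DecidableEq β]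
    {σ : Matrix (Fin 2 × β) (Fin 2 × β) ℂ} (hσ : σ.PosSemidef)
    (hpt : (ptL σ).PosSemidef) (hr : σ.rank ≤ 2) : σ ∈ sepCone (Fin 2) β := by
  obtain ⟨T, -, hT, -⟩ := hσ.exists_gram
  rcases product_decomposition_or_factorization (n := 1) hr hT hpt with
    ⟨e, φ, -, h⟩ | ⟨Q, S, h⟩
  · rw [h]
    exact sum_mem fun i _ => proj_prodVec_mem _ _
  · rw [hT, gram_eq_sum_rows]
    refine sum_mem fun k _ => ?_
    have : star (T k) = prodVec (fun a => star (S a k 0)) (fun s => star (Q 0 s)) := by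
      ext ⟨a, s⟩
      simp [prodVec, h, Matrix.mul_apply]
    rw [this]
    exact proj_prodVec_mem _ _

theorem exists_ker_le_span {n : Type*} [Fintype n] [DecidableEq n] [Nonempty n] (M : Matrix n n ℂ)
    (h : Fintype.card n ≤ M.rank + 1) :
    ∃ u : n → ℂ, u ≠ 0 ∧ ∀ v, M *ᵥ v = 0 → ∃ c : ℂ, v = c • u := by
  have h1 := LinearMap.finrank_range_add_finrank_ker M.mulVecLin
  rw [Module.finrank_fintype_fun_eq_card] at h1
  change M.rank + _ = _ at h1
  obtain ⟨w, hw⟩ := finrank_le_one_iff.mp (show Module.finrank ℂ (LinearMap.ker M.mulVecLin) ≤ 1 by omega)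
  by_cases hw0 : (w : n → ℂ) = 0
  -- The kernel is trivial, so any nonzero vector serves.
  · refine ⟨fun _ => 1, fun h => ?_, fun v hv => ⟨0, ?_⟩⟩
    · exact one_ne_zero (congrFun h (Classical.arbitrary n))
    · obtain ⟨c, hc⟩ := hw ⟨v, hv⟩
      have := congrArg Subtype.val hc
      simpa [hw0] using this.symm
  · refine ⟨w, hw0, fun v hv => ?_⟩
    obtain ⟨c, hc⟩ := hw ⟨v, hv⟩
    exact ⟨c, (congrArg Subtype.val hc).symm⟩

/-- The Hermitian matrix with a given real parameter matrix. -/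
def hermOfReal {n : Type*} (Y : Matrix n n ℝ) : Matrix n n ℂ :=
  Matrix.of fun i j => ⟨Y i j + Y j i, Y i j - Y j i⟩

theorem hermOfReal_isHermitian {n : Type*} (Y : Matrix n n ℝ) : (hermOfReal Y).IsHermitian := by
  ext i j
  apply Complex.ext
  · simp [hermOfReal]; ring
  · simp [hermOfReal]

theorem hermOfReal_eq_zero {n : Type*} {Y : Matrix n n ℝ} (h : hermOfReal Y = 0) : Y = 0 := by
  ext i j
  have h1 := congrFun (congrFun h i) j
  have h2 := congrArg Complex.re h1
  have h3 := congrArg Complex.im h1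
  simp only [hermOfReal, Matrix.of_apply, Matrix.zero_apply, Complex.zero_re, Complex.zero_im]
    at h2 h3
  simp only [Matrix.zero_apply]
  linarith

theorem hermOfReal_add {n : Type*} (Y Z : Matrix n n ℝ) :
    hermOfReal (Y + Z) = hermOfReal Y + hermOfReal Z := by
  ext i j
  apply Complex.ext <;> simp [hermOfReal] <;> ring

theorem hermOfReal_smul {n : Type*} (c : ℝ) (Y : Matrix n n ℝ) :
    hermOfReal (c • Y) = c • hermOfReal Y := by
  ext i j
  apply Complex.ext <;> simp [hermOfReal] <;> ring

/-- u*Xu is real, while the equation makes it purely imaginary. -/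
theorem _root_.Matrix.IsHermitian.eq_zero_of_mulVec_eq_I_smul {n : Type*} [Fintype n]
    {X : Matrix n n ℂ} (hX : X.IsHermitian) {u : n → ℂ} (hu : u ≠ 0) {s : ℝ}
    (h : X *ᵥ u + (s * Complex.I) • u = 0) : s = 0 := by
  have h1 : star u ⬝ᵥ (X *ᵥ u) = -((s * Complex.I) * (star u ⬝ᵥ u)) := by
    rw [eq_neg_of_add_eq_zero_left h, dotProduct_neg, dotProduct_smul, smul_eq_mul]
  have h2 : star (star u ⬝ᵥ (X *ᵥ u)) = star u ⬝ᵥ (X *ᵥ u) := by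
    rw [← Matrix.star_dotProduct_star, star_star, Matrix.star_mulVec, hX.eq, Matrix.dotProduct_mulVec]
  have h3 : star (star u ⬝ᵥ u) = star u ⬝ᵥ u := by
    rw [← Matrix.star_dotProduct_star, star_star]
  have h4 : star u ⬝ᵥ u ≠ 0 := fun h => hu (dotProduct_star_self_eq_zero.mp h)
  rw [h1, star_neg, star_mul, h3, star_mul] at h2
  simp only [Complex.star_def, Complex.conj_I, Complex.conj_ofReal] at h2
  have h5 : (2 * Complex.I * (star u ⬝ᵥ u)) * s = 0 := by linear_combination h2
  have h6 : (2 * Complex.I * (star u ⬝ᵥ u)) ≠ 0 := by simp [h4]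
  exact_mod_cast (mul_eq_zero.mp h5).resolve_left h6

/-- The conditions Xu = 0, X^Γ v = 0 and tr X = 0 amount to 17 real equations on 16 real parameters,
but Im u*Xu = 0 and Im v*X^Γ v = 0 hold automatically. Adding slack terms s·i·u and t·i·v gives 18
unknowns, hence a nonzero solution, and the slacks then vanish. -/
theorem exists_traceless_hermitian (u v : Fin 2 × Fin 2 → ℂ) (hu : u ≠ 0) (hv : v ≠ 0) :
    ∃ X : Matrix (Fin 2 × Fin 2) (Fin 2 × Fin 2) ℂ, X ≠ 0 ∧ X.IsHermitian ∧ X.trace = 0 ∧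
      X *ᵥ u = 0 ∧ ptL X *ᵥ v = 0 := by
  let Ψ : (Matrix (Fin 2 × Fin 2) (Fin 2 × Fin 2) ℝ × ℝ × ℝ) →ₗ[ℝ]
      ((Fin 2 × Fin 2 → ℂ) × (Fin 2 × Fin 2 → ℂ) × ℝ) :=
    { toFun := fun p => (hermOfReal p.1 *ᵥ u + (p.2.1 * Complex.I) • u,
        ptL (hermOfReal p.1) *ᵥ v + (p.2.2 * Complex.I) • v, (hermOfReal p.1).trace.re)
      map_add' := fun p q => by
        simp only [Prod.fst_add, Prod.snd_add, hermOfReal_add, ptL_add, Matrix.add_mulVec,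
          Matrix.trace_add, Complex.add_re, Complex.ofReal_add, add_mul, add_smul, Prod.mk_add_mk,
          Prod.mk.injEq, and_true]
        constructor <;> abel
      map_smul' := fun c p => by
        simp only [Prod.smul_fst, Prod.smul_snd, hermOfReal_smul, ptL_smul, Matrix.smul_mulVec,
          Matrix.trace_smul, Complex.real_smul, Complex.re_ofReal_mul, smul_eq_mul,
          Complex.ofReal_mul, RingHom.id_apply, Prod.smul_mk, smul_add, mul_assoc]
        rw [mul_smul (c : ℂ), mul_smul (c : ℂ), Complex.coe_smul, Complex.coe_smul] }
  have hlt : Module.finrank ℝ ((Fin 2 × Fin 2 → ℂ) × (Fin 2 × Fin 2 → ℂ) × ℝ) <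
      Module.finrank ℝ (Matrix (Fin 2 × Fin 2) (Fin 2 × Fin 2) ℝ × ℝ × ℝ) := by
    have : Module.finrank ℝ (Fin 2 × Fin 2 → ℂ) = 8 := by
      rw [Module.finrank_pi_fintype]; simp [Complex.finrank_real_complex]
    rw [Module.finrank_prod, Module.finrank_prod, Module.finrank_prod, Module.finrank_prod, this,
      Module.finrank_matrix]
    simp
  obtain ⟨⟨Y, s, t⟩, hmem, hne⟩ := Submodule.exists_mem_ne_zero_of_ne_bot
    (LinearMap.ker_ne_bot_of_finrank_lt (f := Ψ) hlt)
  have hΨ : Ψ (Y, s, t) = 0 := hmem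
  have h1 : hermOfReal Y *ᵥ u + (s * Complex.I) • u = 0 := congrArg Prod.fst hΨ
  have h2 : ptL (hermOfReal Y) *ᵥ v + (t * Complex.I) • v = 0 :=
    congrArg (fun p => p.2.1) hΨ
  have h3 : (hermOfReal Y).trace.re = 0 := congrArg (fun p => p.2.2) hΨ
  have hX := hermOfReal_isHermitian Y
  have hs := hX.eq_zero_of_mulVec_eq_I_smul hu h1
  have ht := (ptL_isHermitian hX).eq_zero_of_mulVec_eq_I_smul hv h2
  subst hs ht
  refine ⟨hermOfReal Y, fun h => hne ?_, hX, ?_, by simpa using h1, by simpa using h2⟩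
  · rw [hermOfReal_eq_zero h]; rfl
  · apply Complex.ext
    · exact h3
    · simp [Matrix.trace, hermOfReal]

theorem fromBlocks_posSemidef {n m : Type*} [Fintype n] [Fintype m] [DecidableEq n] [DecidableEq m]
    {A : Matrix n n ℂ} {B : Matrix m m ℂ} (hA : A.PosSemidef) (hB : B.PosSemidef) :
    (Matrix.fromBlocks A 0 0 B).PosSemidef := by
  obtain ⟨V, -, hV, -⟩ := hA.exists_gram
  obtain ⟨V', -, hV', -⟩ := hB.exists_gram
  have : Matrix.fromBlocks A 0 0 B =
      (Matrix.fromBlocks V 0 0 V')ᴴ * Matrix.fromBlocks V 0 0 V' := by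
    rw [Matrix.fromBlocks_conjTranspose, Matrix.fromBlocks_multiply]
    simp [← hV, ← hV']
  rw [this]
  exact Matrix.posSemidef_conjTranspose_mul_self _

/-- The positive partial transpose criterion is sufficient for separability of two qubits. -/
theorem mem_sepCone_of_ppt {σ : Matrix (Fin 2 × Fin 2) (Fin 2 × Fin 2) ℂ} (hσ : σ.PosSemidef)
    (hpt : (ptL σ).PosSemidef) : σ ∈ sepCone (Fin 2) (Fin 2) := by
  -- The block sum tracks σ and σ^Γ together, so one boundary step keeps both positive and lowers
  -- the total rank.
  induction hn : (Matrix.fromBlocks σ 0 0 (ptL σ)).rank using Nat.strong_induction_on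
    generalizing σ with
  | _ n ih =>
  by_cases hr : σ.rank ≤ 2
  · exact mem_sepCone_of_rank_le_two hσ hpt hr
  by_cases hr' : (ptL σ).rank ≤ 2
  · exact ptL_mem_sepCone (mem_sepCone_of_rank_le_two hpt hσ hr')
  obtain ⟨u, hu, hku⟩ := exists_ker_le_span σ (by simp; omega)
  obtain ⟨v, hv, hkv⟩ := exists_ker_le_span (ptL σ) (by simp; omega)
  have key : ∀ X : Matrix (Fin 2 × Fin 2) (Fin 2 × Fin 2) ℂ, X ≠ 0 → X.IsHermitian →
      X.trace = 0 → X *ᵥ u = 0 → ptL X *ᵥ v = 0 →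
      ∃ t : ℝ, 0 < t ∧ σ + t • X ∈ sepCone (Fin 2) (Fin 2) := by
    intro X hX0 hXH hXt hXu hXv
    have hblock : ∀ t : ℝ, Matrix.fromBlocks σ 0 0 (ptL σ) + t • Matrix.fromBlocks X 0 0 (ptL X) =
        Matrix.fromBlocks (σ + t • X) 0 0 (ptL (σ + t • X)) := by
      intro t
      rw [Matrix.fromBlocks_smul, Matrix.fromBlocks_add]
      simp [ptL_add, ptL_smul]
    obtain ⟨t, ht, hpos, hrank⟩ := exists_boundary (fromBlocks_posSemidef hσ hpt)
      (Y := Matrix.fromBlocks X 0 0 (ptL X))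
      (Matrix.IsHermitian.fromBlocks hXH (by simp) (ptL_isHermitian hXH))
      -- A nonzero traceless X cannot be positive semidefinite, so each of the directions X and -X
      -- meets the boundary.
      (fun h => hX0 ((Matrix.PosSemidef.trace_eq_zero_iff (h.submatrix Sum.inl)).mp hXt)) (by
        intro w hw
        rw [Matrix.fromBlocks_mulVec] at hw ⊢
        have h1 : σ *ᵥ (w ∘ Sum.inl) = 0 := by
          ext i; simpa using congrFun hw (Sum.inl i)
        have h2 : ptL σ *ᵥ (w ∘ Sum.inr) = 0 := by
          ext i; simpa using congrFun hw (Sum.inr i)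
        obtain ⟨c, hc⟩ := hku _ h1
        obtain ⟨d, hd⟩ := hkv _ h2
        rw [hc, hd]
        simp only [Matrix.mulVec_smul, hXu, hXv]
        ext i
        cases i <;> simp)
    rw [hblock] at hpos hrank
    exact ⟨t, ht, ih _ (hn ▸ hrank) (hpos.submatrix Sum.inl) (hpos.submatrix Sum.inr) rfl⟩
  obtain ⟨X, hX0, hXH, hXt, hXu, hXv⟩ := exists_traceless_hermitian u v hu hv
  obtain ⟨t, ht, hmem⟩ := key X hX0 hXH hXt hXu hXv
  obtain ⟨s, hs, hmem'⟩ := key (-X) (neg_ne_zero.mpr hX0) hXH.neg (by simp [hXt])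
    (by rw [Matrix.neg_mulVec, hXu, neg_zero])
    (by
      have : ptL (-X) = -ptL X := rfl
      rw [this, Matrix.neg_mulVec, hXv, neg_zero])
  have : σ = (s + t)⁻¹ • (s • (σ + t • X) + t • (σ + s • -X)) := by
    have h0 : s + t ≠ 0 := by positivity
    rw [eq_inv_smul_iff₀ h0]
    module
  rw [this]
  exact smul_mem_sepCone (by positivity)
    (add_mem (smul_mem_sepCone hs.le hmem) (smul_mem_sepCone ht.le hmem'))

end TwoQubits

/-- The cone generated by the fully product projectors of a tripartite system. -/
def fullSepCone (α β γ : Type*) : AddSubmonoid (Matrix (α × β × γ) (α × β × γ) ℂ) :=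
  AddSubmonoid.closure {M | ∃ (e : α → ℂ) (f : β → ℂ) (g : γ → ℂ),
    M = proj (prodVec e (prodVec f g))}

/-! ### The fully separable cone and its normalised elements. -/

section Cones

variable {α β γ n : Type*}

theorem proj_prodVec (e : α → ℂ) (f : β → ℂ) : proj (prodVec e f) = proj e ⊗ₖ proj f := by
  ext x y
  simp only [proj, prodVec, Matrix.kroneckerMap_apply, Matrix.vecMulVec_apply, Pi.star_apply,
    star_mul]
  ring

theorem proj_kronecker_mem_fullSepCone (e : α → ℂ) {σ : Matrix (β × γ) (β × γ) ℂ}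
    (hσ : σ ∈ sepCone β γ) : proj e ⊗ₖ σ ∈ fullSepCone α β γ := by
  induction hσ using AddSubmonoid.closure_induction with
  | mem x hx =>
    obtain ⟨f, g, rfl⟩ := hx
    exact AddSubmonoid.subset_closure ⟨e, f, g, (proj_prodVec _ _).symm⟩
  | zero => rw [Matrix.kronecker_zero]; exact zero_mem _
  | add x y _ _ hx hy => rw [Matrix.kronecker_add]; exact add_mem hx hy

theorem kronecker_proj_mem_fullSepCone {σ : Matrix (α × β) (α × β) ℂ} (hσ : σ ∈ sepCone α β)
    (g : γ → ℂ) : (Matrix.of fun x y : α × β × γ =>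
      σ (x.1, x.2.1) (y.1, y.2.1) * proj g x.2.2 y.2.2) ∈ fullSepCone α β γ := by
  induction hσ using AddSubmonoid.closure_induction with
  | mem x hx =>
    obtain ⟨e, f, rfl⟩ := hx
    refine AddSubmonoid.subset_closure ⟨e, f, g, ?_⟩
    ext x y
    simp only [proj, prodVec, Matrix.of_apply, Matrix.vecMulVec_apply, Pi.star_apply, star_mul]
    ring
  | zero =>
    convert zero_mem (fullSepCone α β γ) using 1
    ext x y
    simp
  | add x y _ _ hx hy =>
    convert add_mem hx hy using 1
    ext x y
    simp [add_mul]

/-- Exchange of the first two parties. -/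
def swapAB (x : β × α × γ) : α × β × γ := (x.2.1, x.1, x.2.2)

theorem mem_fullSepCone_of_swap {ρ : Matrix (α × β × γ) (α × β × γ) ℂ}
    (h : ρ.submatrix swapAB swapAB ∈ fullSepCone β α γ) : ρ ∈ fullSepCone α β γ := by
  have key : ∀ σ ∈ fullSepCone β α γ, σ.submatrix swapAB swapAB ∈ fullSepCone α β γ := by
    intro σ hσ
    induction hσ using AddSubmonoid.closure_induction with
    | mem x hx =>
      obtain ⟨e, f, g, rfl⟩ := hx
      refine AddSubmonoid.subset_closure ⟨f, e, g, ?_⟩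
      ext x y
      simp only [proj, prodVec, swapAB, Matrix.submatrix_apply, Matrix.vecMulVec_apply,
        Pi.star_apply, star_mul]
      ring
    | zero => exact zero_mem _
    | add x y _ _ hx hy => exact add_mem hx hy
  exact key _ h

theorem exists_smul_proj_unit [Fintype n] [DecidableEq n] [Nonempty n] (v : n → ℂ) :
    ∃ (p : ℝ) (u : n → ℂ), 0 ≤ p ∧ star u ⬝ᵥ u = 1 ∧ proj v = p • proj u := by
  by_cases hv : v = 0
  · refine ⟨0, Pi.single (Classical.arbitrary n) 1, le_rfl, ?_, ?_⟩
    · simp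
    · subst hv; ext i j; simp [proj, Matrix.vecMulVec_apply]
  · have hpos : 0 < star v ⬝ᵥ v := Matrix.dotProduct_star_self_pos_iff.mpr hv
    obtain ⟨c, hc0, hc⟩ : ∃ c : ℝ, 0 < c ∧ star v ⬝ᵥ v = c := by
      obtain ⟨h1, h2⟩ := Complex.lt_def.mp hpos
      exact ⟨_, h1, Complex.ext rfl (by simpa using h2.symm)⟩
    have hss : star (((Real.sqrt c)⁻¹ : ℝ) : ℂ) * (((Real.sqrt c)⁻¹ : ℝ) : ℂ) = ((c⁻¹ : ℝ) : ℂ) := by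
      rw [Complex.star_def, Complex.conj_ofReal, ← Complex.ofReal_mul, ← mul_inv,
        Real.mul_self_sqrt hc0.le]
    refine ⟨c, (((Real.sqrt c)⁻¹ : ℝ) : ℂ) • v, hc0.le, ?_, ?_⟩
    · rw [star_smul, smul_dotProduct, dotProduct_smul, hc, smul_eq_mul, smul_eq_mul, ← mul_assoc,
        hss, ← Complex.ofReal_mul, inv_mul_cancel₀ hc0.ne', Complex.ofReal_one]
    · rw [proj_smul, hss, Complex.coe_smul, smul_smul, mul_inv_cancel₀ hc0.ne', one_smul]

theorem trace_proj [Fintype n] (v : n → ℂ) : (proj v).trace = star v ⬝ᵥ v := by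
  rw [proj, Matrix.trace_vecMulVec, dotProduct_comm]

theorem isFullySeparable_of_mem [Fintype α] [Fintype β] [Fintype γ] [DecidableEq α] [DecidableEq β]
    [DecidableEq γ] [Nonempty α] [Nonempty β] [Nonempty γ]
    {ρ : Matrix (α × β × γ) (α × β × γ) ℂ} (h : ρ ∈ fullSepCone α β γ) (htr : ρ.trace = 1) :
    IsFullySeparable ρ := by
  have key : ∀ σ ∈ fullSepCone α β γ, ∃ (ι : Type) (_ : Fintype ι) (p : ι → ℝ) (e : ι → α → ℂ)
      (f : ι → β → ℂ) (g : ι → γ → ℂ), (∀ i, 0 ≤ p i) ∧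
      (∀ i, star (e i) ⬝ᵥ e i = 1 ∧ star (f i) ⬝ᵥ f i = 1 ∧ star (g i) ⬝ᵥ g i = 1) ∧
      σ = ∑ i, p i • (proj (e i) ⊗ₖ (proj (f i) ⊗ₖ proj (g i))) := by
    intro σ hσ
    induction hσ using AddSubmonoid.closure_induction with
    | mem x hx =>
      obtain ⟨e, f, g, rfl⟩ := hx
      obtain ⟨p, e', hp, he, hpe⟩ := exists_smul_proj_unit e
      obtain ⟨q, f', hq, hf, hqf⟩ := exists_smul_proj_unit f
      obtain ⟨r, g', hr, hg, hrg⟩ := exists_smul_proj_unit g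
      refine ⟨Unit, inferInstance, fun _ => r * q * p, fun _ => e', fun _ => f', fun _ => g',
        fun _ => by positivity, fun _ => ⟨he, hf, hg⟩, ?_⟩
      rw [proj_prodVec, proj_prodVec, hpe, hqf, hrg]
      simp [Matrix.smul_kronecker, Matrix.kronecker_smul, smul_smul]
    | zero => exact ⟨Empty, inferInstance, nofun, nofun, nofun, nofun, nofun, nofun, by simp⟩
    | add x y _ _ hx hy =>
      obtain ⟨ι, _, p, e, f, g, hp, hu, rfl⟩ := hx
      obtain ⟨ι', _, p', e', f', g', hp', hu', rfl⟩ := hy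
      refine ⟨ι ⊕ ι', inferInstance, Sum.elim p p', Sum.elim e e', Sum.elim f f', Sum.elim g g',
        ?_, ?_, by simp⟩
      · rintro (i | i)
        · exact hp i
        · exact hp' i
      · rintro (i | i)
        · exact hu i
        · exact hu' i
  obtain ⟨ι, _, p, e, f, g, hp, hu, hρ⟩ := key ρ h
  let s := (Fintype.equivFin ι).symm
  refine ⟨Fintype.card ι, p ∘ s, e ∘ s, f ∘ s, g ∘ s, fun i => hp _, ?_, fun i => hu _, ?_⟩
  · rw [hρ, Matrix.trace_sum] at htr
    simp only [Matrix.trace_smul, Matrix.trace_kronecker, trace_proj, (hu _).1, (hu _).2.1,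
      (hu _).2.2, mul_one, Complex.real_smul] at htr
    rw [Function.comp_def, s.sum_comp p]
    exact_mod_cast htr
  · rw [hρ]
    exact (s.sum_comp fun i => p i • (proj (e i) ⊗ₖ (proj (f i) ⊗ₖ proj (g i)))).symm

end Cones

/-! ### Contracting the first party. -/

section Contraction

variable {α β γ : Type*} [Fintype α] [Fintype β] [Fintype γ] [DecidableEq β] [DecidableEq γ]

theorem insL_conj_kronecker (x e : α → ℂ) (σ : Matrix β β ℂ) :
    (insL β x)ᴴ * (proj e ⊗ₖ σ) * insL β x = ((star x ⬝ᵥ e) * star (star x ⬝ᵥ e)) • σ := by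
  ext s t
  rw [insL_conj_apply]
  simp only [Matrix.smul_apply, smul_eq_mul, dotProduct, star_sum, Finset.sum_mul_sum,
    Matrix.kroneckerMap_apply, proj, Matrix.vecMulVec_apply, Pi.star_apply, star_mul, star_star]
  rw [Finset.sum_comm, Finset.sum_mul]
  refine Finset.sum_congr rfl fun a _ => ?_
  rw [Finset.sum_mul]
  refine Finset.sum_congr rfl fun a' _ => ?_
  ring

theorem ptL_insL_conj (ρ : Matrix (α × β × γ) (α × β × γ) ℂ) (x : α → ℂ) :
    ptL ((insL (β × γ) x)ᴴ * ρ * insL (β × γ) x) =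
      (insL (β × γ) x)ᴴ * ptB ρ * insL (β × γ) x := by
  ext s t
  rw [insL_conj_apply, ptL, Matrix.of_apply, insL_conj_apply]
  rfl

end Contraction

/-! ### Three qubits: sums of at most three terms e ⊗ φ. -/

section ThreeQubits

theorem contraction_mem_sepCone {ρ : Matrix (Fin 2 × Fin 2 × Fin 2) (Fin 2 × Fin 2 × Fin 2) ℂ}
    (hρ : ρ.PosSemidef) (hB : (ptB ρ).PosSemidef) (x : Fin 2 → ℂ) :
    (insL (Fin 2 × Fin 2) x)ᴴ * ρ * insL (Fin 2 × Fin 2) x ∈ sepCone (Fin 2) (Fin 2) := by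
  apply mem_sepCone_of_ppt (hρ.conjTranspose_mul_mul_same _)
  rw [ptL_insL_conj]
  exact hB.conjTranspose_mul_mul_same _

theorem mem_sepCone_of_smul_mem {α β : Type*} {c : ℂ} (hc : c ≠ 0) {σ : Matrix (α × β) (α × β) ℂ}
    (h : (c * star c) • σ ∈ sepCone α β) : σ ∈ sepCone α β := by
  have h1 : c * star c = ((Complex.normSq c : ℝ) : ℂ) := Complex.mul_conj c
  have h2 : 0 < Complex.normSq c := Complex.normSq_pos.mpr hc
  rw [h1, Complex.coe_smul] at h
  have := smul_mem_sepCone (inv_nonneg.mpr h2.le) h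
  rwa [smul_smul, inv_mul_cancel₀ h2.ne', one_smul] at this

/-- Contracting A with a vector orthogonal to e' leaves a positive multiple of σ, which is therefore
a PPT two-qubit operator; likewise for σ'. -/
theorem mem_fullSepCone_of_two_terms
    {ρ : Matrix (Fin 2 × Fin 2 × Fin 2) (Fin 2 × Fin 2 × Fin 2) ℂ} (hρ : ρ.PosSemidef)
    (hB : (ptB ρ).PosSemidef) {e e' : Fin 2 → ℂ} {σ σ' : Matrix (Fin 2 × Fin 2) (Fin 2 × Fin 2) ℂ}
    (hdet : e 0 * e' 1 - e 1 * e' 0 ≠ 0) (h : ρ = proj e ⊗ₖ σ + proj e' ⊗ₖ σ') :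
    ρ ∈ fullSepCone (Fin 2) (Fin 2) (Fin 2) := by
  have hcon : ∀ x : Fin 2 → ℂ, (insL (Fin 2 × Fin 2) x)ᴴ * ρ * insL (Fin 2 × Fin 2) x =
      ((star x ⬝ᵥ e) * star (star x ⬝ᵥ e)) • σ + ((star x ⬝ᵥ e') * star (star x ⬝ᵥ e')) • σ' := by
    intro x
    rw [h, Matrix.mul_add, Matrix.add_mul, insL_conj_kronecker, insL_conj_kronecker]
  have h1 := contraction_mem_sepCone hρ hB ![star (e' 1), -star (e' 0)]
  have h2 := contraction_mem_sepCone hρ hB ![star (e 1), -star (e 0)]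
  rw [hcon] at h1 h2
  have z1 : star ![star (e' 1), -star (e' 0)] ⬝ᵥ e' = 0 := by
    simp [dotProduct, Fin.sum_univ_two]; ring
  have z2 : star ![star (e 1), -star (e 0)] ⬝ᵥ e = 0 := by
    simp [dotProduct, Fin.sum_univ_two]; ring
  have n1 : star ![star (e' 1), -star (e' 0)] ⬝ᵥ e ≠ 0 := by
    intro h0
    apply hdet
    simp [dotProduct, Fin.sum_univ_two] at h0
    linear_combination h0
  have n2 : star ![star (e 1), -star (e 0)] ⬝ᵥ e' ≠ 0 := by
    intro h0
    apply hdet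
    simp [dotProduct, Fin.sum_univ_two] at h0
    linear_combination -h0
  rw [z1, zero_mul, zero_smul, add_zero] at h1
  rw [z2, zero_mul, zero_smul, zero_add] at h2
  rw [h]
  exact add_mem (proj_kronecker_mem_fullSepCone _ (mem_sepCone_of_smul_mem n1 h1))
    (proj_kronecker_mem_fullSepCone _ (mem_sepCone_of_smul_mem n2 h2))

theorem exists_smul_of_det_eq_zero {e e' : Fin 2 → ℂ} (he : e ≠ 0)
    (hdet : e 0 * e' 1 - e 1 * e' 0 = 0) : ∃ c : ℂ, e' = c • e := by
  by_cases h0 : e 0 = 0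
  · have h1 : e 1 ≠ 0 := fun h1 => he (by ext i; fin_cases i; exacts [h0, h1])
    refine ⟨e' 1 / e 1, ?_⟩
    ext i
    fin_cases i
    · simp only [h0, zero_mul, zero_sub, neg_eq_zero, mul_eq_zero, h1, false_or] at hdet
      simp [h0, hdet]
    · simp [h1]
  · refine ⟨e' 0 / e 0, ?_⟩
    ext i
    fin_cases i
    · simp [h0]
    · simp only [Pi.smul_apply, smul_eq_mul, Fin.mk_one]
      field_simp
      linear_combination hdet

theorem mem_fullSepCone_of_parallel
    {ρ : Matrix (Fin 2 × Fin 2 × Fin 2) (Fin 2 × Fin 2 × Fin 2) ℂ} (hρ : ρ.PosSemidef)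
    (hB : (ptB ρ).PosSemidef) {e₀ e₁ e₂ : Fin 2 → ℂ} {φ₀ φ₁ φ₂ : Fin 2 × Fin 2 → ℂ} (he₀ : e₀ ≠ 0)
    (hdet : e₀ 0 * e₁ 1 - e₀ 1 * e₁ 0 = 0)
    (h : ρ = proj (prodVec e₀ φ₀) + proj (prodVec e₁ φ₁) + proj (prodVec e₂ φ₂)) :
    ρ ∈ fullSepCone (Fin 2) (Fin 2) (Fin 2) := by
  obtain ⟨c, rfl⟩ := exists_smul_of_det_eq_zero he₀ hdet
  by_cases h2 : e₀ 0 * e₂ 1 - e₀ 1 * e₂ 0 = 0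
  · obtain ⟨d, rfl⟩ := exists_smul_of_det_eq_zero he₀ h2
    -- All three vectors are parallel; the second direction is any one independent of e₀, with zero
    -- weight.
    refine mem_fullSepCone_of_two_terms hρ hB (e := e₀) (e' := ![-star (e₀ 1), star (e₀ 0)])
      (σ := proj φ₀ + proj (c • φ₁) + proj (d • φ₂)) (σ' := 0) ?_ ?_
    · intro h0
      apply he₀
      rw [← dotProduct_star_self_eq_zero (R := ℂ)]
      simp [dotProduct, Fin.sum_univ_two] at h0 ⊢
      linear_combination h0
    · rw [h, ← smul_prodVec, ← smul_prodVec, ← prodVec_smul, ← prodVec_smul, proj_prodVec,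
        proj_prodVec, proj_prodVec, Matrix.kronecker_add, Matrix.kronecker_add,
        Matrix.kronecker_zero, add_zero]
  · refine mem_fullSepCone_of_two_terms hρ hB (e := e₀) (e' := e₂)
      (σ := proj φ₀ + proj (c • φ₁)) (σ' := proj φ₂) h2 ?_
    rw [h, ← smul_prodVec, ← prodVec_smul, proj_prodVec, proj_prodVec, proj_prodVec,
      Matrix.kronecker_add]

theorem exists_prodVec_of_det_eq_zero {φ : Fin 2 × Fin 2 → ℂ}
    (h : φ (0, 0) * φ (1, 1) - φ (0, 1) * φ (1, 0) = 0) :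
    ∃ f g : Fin 2 → ℂ, φ = prodVec f g := by
  by_cases h0 : (fun c => φ (0, c)) = (0 : Fin 2 → ℂ)
  · refine ⟨![0, 1], fun c => φ (1, c), ?_⟩
    ext ⟨b, c⟩
    have := congrFun h0 c
    fin_cases b
    · simpa [prodVec] using this
    · simp [prodVec]
  · obtain ⟨t, ht⟩ := exists_smul_of_det_eq_zero (e' := fun c => φ (1, c)) h0 h
    refine ⟨![1, t], fun c => φ (0, c), ?_⟩
    ext ⟨b, c⟩
    have := congrFun ht c
    fin_cases b
    · simp [prodVec]
    · simpa [prodVec] using this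

theorem exists_ne_zero_quadratic (a b c : ℂ) :
    ∃ f : Fin 2 → ℂ, f ≠ 0 ∧ a * f 0 ^ 2 + b * (f 0 * f 1) + c * f 1 ^ 2 = 0 := by
  by_cases ha : a = 0
  · exact ⟨![1, 0], fun h => one_ne_zero (congrFun h 0), by simp [ha]⟩
  · obtain ⟨s, hs⟩ := IsAlgClosed.exists_eq_mul_self (discrim a b c)
    obtain ⟨x, hx⟩ := exists_quadratic_eq_zero ha ⟨s, hs⟩
    refine ⟨![x, 1], fun h => one_ne_zero (congrFun h 1), ?_⟩
    simp
    linear_combination hx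

/-- Two two-qubit vectors are annihilated by a common product functional. -/
theorem exists_product_annihilator (φ ψ : Fin 2 × Fin 2 → ℂ) :
    ∃ f g : Fin 2 → ℂ, f ≠ 0 ∧ g ≠ 0 ∧ ∑ b, ∑ c, f b * φ (b, c) * g c = 0 ∧
      ∑ b, ∑ c, f b * ψ (b, c) * g c = 0 := by
  -- The coefficients are those of the determinant, as a quadratic form in f, of the 2 × 2 system
  -- for g with rows fᵀφ and fᵀψ.
  obtain ⟨f, hf, hq⟩ := exists_ne_zero_quadratic
    (φ (0, 0) * ψ (0, 1) - φ (0, 1) * ψ (0, 0))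
    (φ (0, 0) * ψ (1, 1) + φ (1, 0) * ψ (0, 1) - φ (0, 1) * ψ (1, 0) - φ (1, 1) * ψ (0, 0))
    (φ (1, 0) * ψ (1, 1) - φ (1, 1) * ψ (1, 0))
  have hdet : (!![f 0 * φ (0, 0) + f 1 * φ (1, 0), f 0 * φ (0, 1) + f 1 * φ (1, 1);
      f 0 * ψ (0, 0) + f 1 * ψ (1, 0), f 0 * ψ (0, 1) + f 1 * ψ (1, 1)] :
        Matrix (Fin 2) (Fin 2) ℂ).det = 0 := by
    rw [Matrix.det_fin_two_of]
    linear_combination hq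
  obtain ⟨g, hg, hk⟩ := Matrix.exists_mulVec_eq_zero_iff.mpr hdet
  refine ⟨f, g, hf, hg, ?_, ?_⟩
  · have := congrFun hk 0
    simp [Matrix.mulVec, dotProduct, Fin.sum_univ_two] at this
    simp only [Fin.sum_univ_two]
    linear_combination this
  · have := congrFun hk 1
    simp [Matrix.mulVec, dotProduct, Fin.sum_univ_two] at this
    simp only [Fin.sum_univ_two]
    linear_combination this

theorem ptB_proj_mulVec (e x f g : Fin 2 → ℂ) (φ : Fin 2 × Fin 2 → ℂ) :
    ptB (proj (prodVec e φ)) *ᵥ prodVec x (prodVec f (star g)) =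
      fun p => e p.1 * (star e ⬝ᵥ x) * (star (∑ c, φ (p.2.1, c) * g c)) *
        (∑ b, f b * φ (b, p.2.2)) := by
  ext ⟨a, b, c⟩
  simp only [ptB, proj, prodVec, Matrix.mulVec, dotProduct, Matrix.of_apply, Matrix.vecMulVec_apply,
    Fintype.sum_prod_type, Fin.sum_univ_two, Pi.star_apply, star_mul, star_add]
  ring

theorem star_dotProduct_ptB_proj_mulVec (e x f g : Fin 2 → ℂ) (φ : Fin 2 × Fin 2 → ℂ) :
    star (prodVec x (prodVec f (star g))) ⬝ᵥ
      (ptB (proj (prodVec e φ)) *ᵥ prodVec x (prodVec f (star g))) =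
      star (star e ⬝ᵥ x) * (star e ⬝ᵥ x) * star (∑ b, ∑ c, f b * φ (b, c) * g c) *
        (∑ b, ∑ c, f b * φ (b, c) * g c) := by
  rw [ptB_proj_mulVec]
  simp only [prodVec, dotProduct, Fintype.sum_prod_type, Fin.sum_univ_two, Pi.star_apply, star_mul,
    star_add, star_star]
  ring

/-- Choose x orthogonal to e₀ and f, g annihilating φ₁ and φ₂. Then x ⊗ f ⊗ ḡ has zero expectation
in ρ^{t_B}, hence lies in its kernel. As e₁ and e₂ are independent, the φ₁ term vanishes alone, so
φ₁g = 0 or fᵀφ₁ = 0. -/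
theorem det_eq_zero_of_pairwise_independent
    {ρ : Matrix (Fin 2 × Fin 2 × Fin 2) (Fin 2 × Fin 2 × Fin 2) ℂ}
    (hB : (ptB ρ).PosSemidef) {e₀ e₁ e₂ : Fin 2 → ℂ} {φ₀ φ₁ φ₂ : Fin 2 × Fin 2 → ℂ}
    (h01 : e₀ 0 * e₁ 1 - e₀ 1 * e₁ 0 ≠ 0) (h12 : e₁ 0 * e₂ 1 - e₁ 1 * e₂ 0 ≠ 0)
    (h : ρ = proj (prodVec e₀ φ₀) + proj (prodVec e₁ φ₁) + proj (prodVec e₂ φ₂)) :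
    φ₁ (0, 0) * φ₁ (1, 1) - φ₁ (0, 1) * φ₁ (1, 0) = 0 := by
  obtain ⟨f, g, hf, hg, hfg1, hfg2⟩ := exists_product_annihilator φ₁ φ₂
  set x : Fin 2 → ℂ := ![-star (e₀ 1), star (e₀ 0)] with hx
  have hx0 : star e₀ ⬝ᵥ x = 0 := by
    simp [hx, dotProduct, Fin.sum_univ_two]; ring
  have hx1 : star e₁ ⬝ᵥ x ≠ 0 := by
    intro h0
    apply h01
    have := congrArg star h0
    simp [hx, dotProduct, Fin.sum_univ_two] at this
    linear_combination this
  set z := prodVec x (prodVec f (star g)) with hz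
  have hptB : ptB ρ = ptB (proj (prodVec e₀ φ₀)) + ptB (proj (prodVec e₁ φ₁)) +
      ptB (proj (prodVec e₂ φ₂)) := by rw [h]; rfl
  have hq : star z ⬝ᵥ (ptB ρ *ᵥ z) = 0 := by
    rw [hptB, Matrix.add_mulVec, Matrix.add_mulVec, dotProduct_add, dotProduct_add, hz,
      star_dotProduct_ptB_proj_mulVec, star_dotProduct_ptB_proj_mulVec,
      star_dotProduct_ptB_proj_mulVec, hx0, hfg1, hfg2]
    simp
  have hzero : ptB ρ *ᵥ z = 0 := (hB.dotProduct_mulVec_zero_iff z).mp hq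
  rw [hptB, Matrix.add_mulVec, Matrix.add_mulVec, hz, ptB_proj_mulVec, ptB_proj_mulVec,
    ptB_proj_mulVec, hx0] at hzero
  have hprod : ∀ b c, star (∑ c, φ₁ (b, c) * g c) * (∑ b, f b * φ₁ (b, c)) = 0 := by
    intro b c
    have k0 := congrFun hzero (0, b, c)
    have k1 := congrFun hzero (1, b, c)
    simp only [Pi.add_apply, Pi.zero_apply, mul_zero, zero_mul, zero_add] at k0 k1
    have : (e₁ 0 * e₂ 1 - e₁ 1 * e₂ 0) * (star e₁ ⬝ᵥ x) *
        (star (∑ c, φ₁ (b, c) * g c) * (∑ b, f b * φ₁ (b, c))) = 0 := by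
      -- Taking the determinant against e₂ in the A index removes the e₂ term.
      linear_combination e₂ 1 * k0 - e₂ 0 * k1
    exact (mul_eq_zero.mp this).resolve_left (mul_ne_zero h12 hx1)
  have hmat : (!![φ₁ (0, 0), φ₁ (0, 1); φ₁ (1, 0), φ₁ (1, 1)] : Matrix (Fin 2) (Fin 2) ℂ).det = 0 := by
    by_cases hcol : ∀ b, ∑ c, φ₁ (b, c) * g c = 0
    · apply Matrix.exists_mulVec_eq_zero_iff.mp
      refine ⟨g, hg, ?_⟩
      ext b
      have := hcol b
      fin_cases b <;> simpa [Matrix.mulVec, dotProduct, Fin.sum_univ_two] using this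
    · push Not at hcol
      obtain ⟨b, hb⟩ := hcol
      apply Matrix.exists_vecMul_eq_zero_iff.mp
      refine ⟨f, hf, ?_⟩
      ext c
      have := (mul_eq_zero.mp (hprod b c)).resolve_left (star_ne_zero.mpr hb)
      fin_cases c <;> simpa [Matrix.vecMul, dotProduct, Fin.sum_univ_two] using this
  rwa [Matrix.det_fin_two_of] at hmat

theorem mem_fullSepCone_of_three_terms
    {ρ : Matrix (Fin 2 × Fin 2 × Fin 2) (Fin 2 × Fin 2 × Fin 2) ℂ} (hρ : ρ.PosSemidef)
    (hB : (ptB ρ).PosSemidef) {e : Fin 3 → Fin 2 → ℂ} {φ : Fin 3 → Fin 2 × Fin 2 → ℂ}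
    (he : ∀ i, e i ≠ 0) (h : ρ = ∑ i, proj (prodVec (e i) (φ i))) :
    ρ ∈ fullSepCone (Fin 2) (Fin 2) (Fin 2) := by
  rw [Fin.sum_univ_three] at h
  by_cases h01 : e 0 0 * e 1 1 - e 0 1 * e 1 0 = 0
  · exact mem_fullSepCone_of_parallel hρ hB (he 0) h01 h
  have h201 : ρ = proj (prodVec (e 2) (φ 2)) + proj (prodVec (e 0) (φ 0)) +
      proj (prodVec (e 1) (φ 1)) := by rw [h]; abel
  have h120 : ρ = proj (prodVec (e 1) (φ 1)) + proj (prodVec (e 2) (φ 2)) +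
      proj (prodVec (e 0) (φ 0)) := by rw [h]; abel
  by_cases h20 : e 2 0 * e 0 1 - e 2 1 * e 0 0 = 0
  · exact mem_fullSepCone_of_parallel hρ hB (he 2) h20 h201
  by_cases h12 : e 1 0 * e 2 1 - e 1 1 * e 2 0 = 0
  · exact mem_fullSepCone_of_parallel hρ hB (he 1) h12 h120
  obtain ⟨f₁, g₁, h1⟩ := exists_prodVec_of_det_eq_zero (det_eq_zero_of_pairwise_independent hB h01 h12 h)
  obtain ⟨f₂, g₂, h2⟩ :=
    exists_prodVec_of_det_eq_zero (det_eq_zero_of_pairwise_independent hB h12 h20 h120)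
  obtain ⟨f₀, g₀, h0⟩ :=
    exists_prodVec_of_det_eq_zero (det_eq_zero_of_pairwise_independent hB h20 h01 h201)
  rw [h, h0, h1, h2]
  exact add_mem (add_mem (AddSubmonoid.subset_closure ⟨_, _, _, rfl⟩)
    (AddSubmonoid.subset_closure ⟨_, _, _, rfl⟩)) (AddSubmonoid.subset_closure ⟨_, _, _, rfl⟩)

end ThreeQubits

/-! ### Three qubits: the compressed case and the conclusion. -/

section ThreeQubits

variable {κ : Type*} [Fintype κ] {T : Matrix κ (Fin 2 × Fin 2 × Fin 2) ℂ}
  {ρ : Matrix (Fin 2 × Fin 2 × Fin 2) (Fin 2 × Fin 2 × Fin 2) ℂ}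

/-- Here ρ is an operator on A tensored with one projector on BC. Contracting A gives a positive
multiple of that projector, so it is separable. -/
theorem mem_fullSepCone_of_product_rows (hT : ρ = Tᴴ * T) (hB : (ptB ρ).PosSemidef)
    {X : κ → Fin 2 → ℂ} {w : Fin 2 × Fin 2 → ℂ} (h : ∀ j a s, T j (a, s) = X j a * w s) :
    ρ ∈ fullSepCone (Fin 2) (Fin 2) (Fin 2) := by
  have hρ : ρ.PosSemidef := by rw [hT]; exact Matrix.posSemidef_conjTranspose_mul_self T
  have hsum : ρ = ∑ j, proj (star (X j)) ⊗ₖ proj (star w) := by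
    rw [hT, gram_eq_sum_rows]
    refine Finset.sum_congr rfl fun j _ => ?_
    rw [← proj_prodVec]
    congr 1
    ext ⟨a, s⟩
    simp [prodVec, h]
  rw [hsum]
  refine sum_mem fun j _ => ?_
  by_cases hX : X j = 0
  · have : proj (star (X j)) = 0 := by rw [hX]; ext; simp [proj, Matrix.vecMulVec_apply]
    rw [this, Matrix.zero_kronecker]
    exact zero_mem _
  apply proj_kronecker_mem_fullSepCone
  have hcon := contraction_mem_sepCone hρ hB (star (X j))
  rw [hsum, Matrix.mul_sum, Matrix.sum_mul] at hcon
  simp only [insL_conj_kronecker, star_star] at hcon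
  rw [← Finset.sum_smul] at hcon
  set c : ℝ := ∑ i, Complex.normSq (X j ⬝ᵥ star (X i)) with hc
  have hcs : ∑ i, (X j ⬝ᵥ star (X i)) * star (X j ⬝ᵥ star (X i)) = (c : ℂ) := by
    rw [hc, Complex.ofReal_sum]
    exact Finset.sum_congr rfl fun i _ => Complex.mul_conj _
  rw [hcs, Complex.coe_smul] at hcon
  have hpos : 0 < c := by
    refine Finset.sum_pos' (fun i _ => Complex.normSq_nonneg _) ⟨j, Finset.mem_univ _, ?_⟩
    rw [Complex.normSq_pos]
    exact fun h0 => hX (dotProduct_self_star_eq_zero.mp h0)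
  have := smul_mem_sepCone (inv_nonneg.mpr hpos.le) hcon
  rwa [smul_smul, inv_mul_cancel₀ hpos.ne', one_smul] at this

/-- ρ is an AB operator times a projector on C. The AB operator is the block of ρ at c₀, and
inherits positivity of its partial transpose from `ptA`. -/
theorem mem_fullSepCone_of_last_factor (hT : ρ = Tᴴ * T) (hA : (ptA ρ).PosSemidef)
    {c₀ : Fin 2} {g : Fin 2 → ℂ} (h : ∀ j a b c, T j (a, b, c) = T j (a, b, c₀) * g c) :
    ρ ∈ fullSepCone (Fin 2) (Fin 2) (Fin 2) := by
  have hρ : ρ.PosSemidef := by rw [hT]; exact Matrix.posSemidef_conjTranspose_mul_self T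
  let ι : Fin 2 × Fin 2 → Fin 2 × Fin 2 × Fin 2 := fun x => (x.1, x.2, c₀)
  have hσ : ρ.submatrix ι ι ∈ sepCone (Fin 2) (Fin 2) :=
    mem_sepCone_of_ppt (hρ.submatrix ι) (hA.submatrix ι)
  convert kronecker_proj_mem_fullSepCone hσ (star g) using 1
  ext ⟨a, b, c⟩ ⟨a', b', c'⟩
  simp only [hT, Matrix.of_apply, Matrix.submatrix_apply, ι, Matrix.mul_apply,
    Matrix.conjTranspose_apply, proj, Matrix.vecMulVec_apply, star_star, Pi.star_apply,
    Finset.sum_mul]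
  refine Finset.sum_congr rfl fun j _ => ?_
  rw [h j a b c, h j a' b' c', star_mul]
  ring

theorem mem_fullSepCone_of_full_rank_slice {k : ℕ} (hk : k ≤ 3)
    {T : Matrix (Fin k) (Fin 2 × Fin 2 × Fin 2) ℂ} (hT : ρ = Tᴴ * T) (hA : (ptA ρ).PosSemidef)
    (hB : (ptB ρ).PosSemidef) {f : Fin 2 → ℂ} (hf : f ≠ 0) {W : Matrix (Fin 2 × Fin 2) (Fin k) ℂ}
    (hW : T.submatrix id swapAB * insL (Fin 2 × Fin 2) f * W = 1) :
    ρ ∈ fullSepCone (Fin 2) (Fin 2) (Fin 2) := by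
  have hρ : ρ.PosSemidef := by rw [hT]; exact Matrix.posSemidef_conjTranspose_mul_self T
  apply mem_fullSepCone_of_swap
  have hT' : ρ.submatrix swapAB swapAB = (T.submatrix id swapAB)ᴴ * T.submatrix id swapAB := by
    rw [hT]; rfl
  obtain ⟨e, φ, he, h⟩ := exists_product_decomposition (n := 3) (by simpa using hk) hT'
    (hB.submatrix swapAB) hf hW
  exact mem_fullSepCone_of_three_terms (hρ.submatrix swapAB) (hA.submatrix swapAB) he h

/-- A pencil of singular `2 × 2` matrices has a common right kernel vector or a common left kernel
vector. -/
theorem singular_pencil {X Y : Matrix (Fin 2) (Fin 2) ℂ}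
    (h : ∀ s t : ℂ, (s • X + t • Y).det = 0) :
    (∃ g : Fin 2 → ℂ, g ≠ 0 ∧ X *ᵥ g = 0 ∧ Y *ᵥ g = 0) ∨
      ∃ y : Fin 2 → ℂ, y ≠ 0 ∧ y ᵥ* X = 0 ∧ y ᵥ* Y = 0 := by
  have hX : X.det = 0 := by simpa using h 1 0
  have hY : Y.det = 0 := by simpa using h 0 1
  have hXY := h 1 1
  rw [Matrix.det_fin_two] at hX hY hXY
  obtain ⟨x, ξ, hx⟩ := exists_prodVec_of_det_eq_zero (φ := fun p => X p.1 p.2) hX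
  obtain ⟨w, ζ, hw⟩ := exists_prodVec_of_det_eq_zero (φ := fun p => Y p.1 p.2) hY
  have hX' : X = Matrix.vecMulVec x ξ := by
    ext i j; exact congrFun hx (i, j)
  have hY' : Y = Matrix.vecMulVec w ζ := by
    ext i j; exact congrFun hw (i, j)
  -- For X = xξᵀ and Y = wζᵀ, det(X + Y) = det(x, w) · det(ξ, ζ).
  have hprod : (x 0 * w 1 - x 1 * w 0) * (ξ 0 * ζ 1 - ξ 1 * ζ 0) = 0 := by
    simp only [hX', hY', one_smul, Matrix.add_apply, Matrix.vecMulVec_apply] at hXY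
    linear_combination hXY
  have hkernel : ∀ p r : Fin 2 → ℂ, p 0 * r 1 - p 1 * r 0 = 0 →
      ∃ g : Fin 2 → ℂ, g ≠ 0 ∧ p ⬝ᵥ g = 0 ∧ r ⬝ᵥ g = 0 := by
    intro p r hpr
    have hdet : (Matrix.of ![p, r]).det = 0 := by
      rw [Matrix.det_fin_two]
      simpa using hpr
    obtain ⟨g, hg, hk⟩ := Matrix.exists_mulVec_eq_zero_iff.mpr hdet
    exact ⟨g, hg, congrFun hk 0, congrFun hk 1⟩
  rcases mul_eq_zero.mp hprod with h0 | h0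
  · right
    obtain ⟨y, hy, h1, h2⟩ := hkernel x w h0
    refine ⟨y, hy, ?_, ?_⟩
    · rw [hX', Matrix.vecMul_vecMulVec, dotProduct_comm, h1, zero_smul]
    · rw [hY', Matrix.vecMul_vecMulVec, dotProduct_comm, h2, zero_smul]
  · left
    obtain ⟨g, hg, h1, h2⟩ := hkernel ξ ζ h0
    refine ⟨g, hg, ?_, ?_⟩
    · rw [hX', Matrix.vecMulVec_mulVec, h1]; simp
    · rw [hY', Matrix.vecMulVec_mulVec, h2]; simp

theorem mem_fullSepCone_of_rank_le_three (hρ : ρ.PosSemidef) (hA : (ptA ρ).PosSemidef)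
    (hB : (ptB ρ).PosSemidef) (hr : ρ.rank ≤ 3) : ρ ∈ fullSepCone (Fin 2) (Fin 2) (Fin 2) := by
  obtain ⟨T, W, hT, hTW⟩ := hρ.exists_gram
  rcases product_decomposition_or_factorization (n := 2) hr hT hA with
    ⟨e, φ, he, h⟩ | ⟨Q, S, h⟩
  · exact mem_fullSepCone_of_three_terms hρ hB he h
  let q : Fin 2 → Matrix (Fin 2) (Fin 2) ℂ := fun b => Matrix.of fun l c => Q l (b, c)
  by_cases hdet : ∃ s t : ℂ, (s • q 0 + t • q 1).det ≠ 0
  · obtain ⟨s, t, hst⟩ := hdet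
    set R := s • q 0 + t • q 1 with hR
    let S' : Matrix (Fin ρ.rank) (Fin 2 × Fin 2) ℂ := Matrix.of fun j p => S p.1 j p.2
    have hTS : T = S' * ((1 : Matrix (Fin 2) (Fin 2) ℂ) ⊗ₖ Q) := by
      ext j ⟨a, p⟩
      rw [h, Matrix.mul_apply, Matrix.mul_apply, Fintype.sum_prod_type]
      simp [S', Matrix.kroneckerMap_apply, Matrix.one_apply, ite_mul, mul_ite,
        Finset.sum_ite_irrel]
    have hslice : T.submatrix id swapAB * insL (Fin 2 × Fin 2) ![s, t] =
        S' * ((1 : Matrix (Fin 2) (Fin 2) ℂ) ⊗ₖ R) := by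
      ext j ⟨a, c⟩
      rw [mul_insL_apply, Matrix.mul_apply, Fintype.sum_prod_type]
      simp only [Fin.sum_univ_two, Matrix.submatrix_apply, swapAB, id, h, Matrix.mul_apply, S', hR,
        q, Matrix.of_apply, Matrix.kroneckerMap_apply, Matrix.one_apply, Matrix.add_apply,
        Matrix.smul_apply, smul_eq_mul, Matrix.cons_val_zero, Matrix.cons_val_one]
      fin_cases a
      · simp; ring
      · simp; ring
    have hRinv : R * R⁻¹ = 1 := Matrix.mul_nonsing_inv _ (isUnit_iff_ne_zero.mpr hst)
    -- The slice is S'(1 ⊗ R) while T = S'(1 ⊗ Q); multiplying by 1 ⊗ R⁻¹Q recovers T, whose right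
    -- inverse is W.
    refine mem_fullSepCone_of_full_rank_slice hr hT hA hB (f := ![s, t])
      (W := ((1 : Matrix (Fin 2) (Fin 2) ℂ) ⊗ₖ (R⁻¹ * Q)) * W) ?_ ?_
    · intro h0
      have hs : s = 0 := congrFun h0 0
      have ht : t = 0 := congrFun h0 1
      apply hst
      simp [hR, hs, ht]
    · rw [hslice, Matrix.mul_assoc, ← Matrix.mul_assoc (_ ⊗ₖ R), ← Matrix.mul_kronecker_mul,
        Matrix.one_mul, ← Matrix.mul_assoc R, hRinv, Matrix.one_mul, ← Matrix.mul_assoc, ← hTS, hTW]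
  · push Not at hdet
    rcases singular_pencil hdet with ⟨g, hg, h0, h1⟩ | ⟨y, hy, h0, h1⟩
    · have hq : ∀ b l, Q l (b, 0) * g 0 + Q l (b, 1) * g 1 = 0 := by
        intro b l
        fin_cases b
        · simpa [Matrix.mulVec, dotProduct, q] using congrFun h0 l
        · simpa [Matrix.mulVec, dotProduct, q] using congrFun h1 l
      have hTg : ∀ j a b, T j (a, b, 0) * g 0 + T j (a, b, 1) * g 1 = 0 := by
        intro j a b
        simp only [h, Matrix.mul_apply, Finset.sum_mul, ← Finset.sum_add_distrib]
        refine Finset.sum_eq_zero fun l _ => ?_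
        linear_combination S a j l * hq b l
      by_cases hg0 : g 0 = 0
      · have hg1 : g 1 ≠ 0 := fun hg1 => hg (by ext i; fin_cases i; exacts [hg0, hg1])
        refine mem_fullSepCone_of_last_factor hT hA (c₀ := 0) (g := ![1, 0]) ?_
        intro j a b c
        have := hTg j a b
        fin_cases c
        · simp
        · simpa [hg0, hg1] using this
      · refine mem_fullSepCone_of_last_factor hT hA (c₀ := 1) (g := ![-(g 1 / g 0), 1]) ?_
        intro j a b c
        have := hTg j a b
        fin_cases c
        · simp
          field_simp
          linear_combination this
        · simp
    · have hq : ∀ s, y 0 * Q 0 s + y 1 * Q 1 s = 0 := by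
        rintro ⟨b, c⟩
        fin_cases b
        · simpa [Matrix.vecMul, dotProduct, q] using congrFun h0 c
        · simpa [Matrix.vecMul, dotProduct, q] using congrFun h1 c
      by_cases hy0 : y 0 = 0
      · have hy1 : y 1 ≠ 0 := fun hy1 => hy (by ext i; fin_cases i; exacts [hy0, hy1])
        refine mem_fullSepCone_of_product_rows hT hB (X := fun j a => S a j 0) (w := Q 0) ?_
        intro j a s
        have h2 : Q 1 s = 0 := by simpa [hy0, hy1] using hq s
        rw [h, Matrix.mul_apply, Fin.sum_univ_two, h2, mul_zero, add_zero]
      -- The two rows of Q are proportional, so Q 0 is eliminated and every row of T becomes a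
      -- vector on A times Q 1.
      · refine mem_fullSepCone_of_product_rows hT hB
          (X := fun j a => S a j 1 - S a j 0 * (y 1 / y 0)) (w := Q 1) ?_
        intro j a s
        have h2 : Q 0 s = -(y 1 / y 0) * Q 1 s := by
          field_simp
          linear_combination hq s
        rw [h, Matrix.mul_apply, Fin.sum_univ_two, h2]
        ring

end ThreeQubits

theorem IsPPTState.isFullySeparable_of_rank_le_three
    {ρ : Matrix (Fin 2 × Fin 2 × Fin 2) (Fin 2 × Fin 2 × Fin 2) ℂ} (h : IsPPTState ρ)
    (hr : ρ.rank ≤ 3) : IsFullySeparable ρ :=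
  isFullySeparable_of_mem (mem_fullSepCone_of_rank_le_three h.posSemidef h.ptA_posSemidef
    h.ptB_posSemidef hr) h.trace_eq_one

end ThreeParty

theorem lemma5 :
    (∀ ρ : Matrix (Fin 2 × Fin 2 × Fin 2) (Fin 2 × Fin 2 × Fin 2) ℂ,
      ThreeParty.IsPPTState ρ → ρ.rank = 3 → ThreeParty.IsFullySeparable ρ) ∧
    ¬ ∃ ρ : Matrix (Fin 2 × Fin 2 × Fin 2) (Fin 2 × Fin 2 × Fin 2) ℂ,
      ThreeParty.IsPPTState ρ ∧ ρ.rank < 4 ∧ ¬ ThreeParty.IsFullySeparable ρ :=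
  ⟨fun _ h hr => h.isFullySeparable_of_rank_le_three hr.le,
    fun ⟨_, h, hr, hn⟩ => hn (h.isFullySeparable_of_rank_le_three (by omega))⟩
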